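/- Let $k$ be a commutative ring with $1$, let $\delta\in k$ and let $n\ge 1$. Let $TL_n(\delta)$ be the unital $k$-algebra generated by $e_1,\dots,e_{n-1}$ subject to the relations $e_i^2=\delta e_i$, $e_ie_je_i=e_i$ if $|i-j|=1$, and $e_ie_j=e_je_i$ if $|i-j|>1$. An $n$-diagram is a partition into two-element blocks of the $2n$ points consisting of $n$ marked points on each of two parallel lines (top and bottom) such that the blocks can be drawn as pairwise non-intersecting arcs between the two lines. Let $D_n(\delta)$ be the free $k$-module on the set of $n$-diagrams with the bilinear multiplication $d_1d_2=\delta^{L}d_3$, where $d_3$ is the $n$-diagram obtained by stacking $d_1$ on top of $d_2$, identifying the middle lines, and removing the middle line and the $L$ loops that have been formed; it is an associative unital $k$-algebra, whose unit is the diagram joining each top point to the bottom point below it. Let $\hat e_i$ be the $n$-diagram that joins the points $i$ and $i+1$ on the top line, joins the points $i$ and $i+1$ on the bottom line, and joins every other top point to the bottom point below it. A word in the generators is in Jones normal form if it is of the form $$(e_{j_1}e_{j_1-1}\cdots e_{k_1})(e_{j_2}e_{j_2-1}\cdots e_{k_2})\cdots(e_{j_r}e_{j_r-1}\cdots e_{k_r}),$$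 where $r\ge 0$, $0<j_1<\dots<j_r<n$, $0<k_1<\dots<k_r<n$ and $j_i\ge k_i$ for all $i$. Let $\Omega$ be the set of these words. Then there is a unique $k$-algebra homomorphism $\sigma: TL_n(\delta)\to D_n(\delta)$ with $\sigma(e_i)=\hat e_i$ for all $i$, and it is an isomorphism. It sends the words in Jones normal form bijectively to the $n$-diagrams: there is a bijection $f$ from $\Omega$ to the set of $n$-diagrams such that $\sigma(w)=f(w)$ in $D_n(\delta)$ for every $w\in\Omega$. Hence $TL_n(\delta)$ is a free $k$-module with basis $\Omega$ (the family of the elements of $TL_n(\delta)$ represented by the words in $\Omega$), and $\Omega$ has exactly $\frac{1}{n+1}\binom{2n}{n}$ elements; in particular, if $k\neq 0$, then the rank of $TL_n(\delta)$ over $k$ is the Catalan number $\frac{1}{n+1}\binom{2n}{n}$. -/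

import Mathlib

namespace TemperleyLieb

section Presentation

variable {k : Type*} [CommRing k]

/-- The defining relations of the Temperley-Lieb algebra. The generators `e_1, …, e_{n-1}` are
indexed from `0`, by `Fin (n - 1)`. -/
inductive Rel (n : ℕ) (δ : k) :
    FreeAlgebra k (Fin (n - 1)) → FreeAlgebra k (Fin (n - 1)) → Prop
  | sq (i : Fin (n - 1)) :
      Rel n δ (FreeAlgebra.ι k i * FreeAlgebra.ι k i) (δ • FreeAlgebra.ι k i)
  | braid (i j : Fin (n - 1)) (h : (i : ℕ) + 1 = j ∨ (j : ℕ) + 1 = i) :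
      Rel n δ (FreeAlgebra.ι k i * FreeAlgebra.ι k j * FreeAlgebra.ι k i) (FreeAlgebra.ι k i)
  | comm (i j : Fin (n - 1)) (h : (i : ℕ) + 1 < j ∨ (j : ℕ) + 1 < i) :
      Rel n δ (FreeAlgebra.ι k i * FreeAlgebra.ι k j) (FreeAlgebra.ι k j * FreeAlgebra.ι k i)

/-- The Temperley-Lieb algebra `TL_n(δ)`, by generators and relations. -/
def TL (n : ℕ) (δ : k) : Type _ := RingQuot (Rel n δ)

instance (n : ℕ) (δ : k) : Ring (TL n δ) := inferInstanceAs (Ring (RingQuot (Rel n δ)))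

instance (n : ℕ) (δ : k) : Algebra k (TL n δ) := inferInstanceAs (Algebra k (RingQuot (Rel n δ)))

/-- The generators of `TL_n(δ)`. -/
def gen {n : ℕ} (δ : k) (i : Fin (n - 1)) : TL n δ :=
  RingQuot.mkAlgHom k (Rel n δ) (FreeAlgebra.ι k i)

/-- The element of `TL_n(δ)` represented by a word in the generators. -/
def wordProd {n : ℕ} (δ : k) (w : List (Fin (n - 1))) : TL n δ := (w.map (gen δ)).prod

end Presentation

/-- The descending word `j, j - 1, …, l`. -/
def descWord {m : ℕ} (j l : Fin m) : List (Fin m) :=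
  ((List.finRange m).filter (fun i => l ≤ i ∧ i ≤ j)).reverse

/-- Words in Jones normal form:
`(e_{j₁} e_{j₁-1} ⋯ e_{l₁}) ⋯ (e_{jᵣ} e_{jᵣ-1} ⋯ e_{lᵣ})` with `j₁ < ⋯ < jᵣ`, `l₁ < ⋯ < lᵣ` and
`lᵢ ≤ jᵢ` for all `i`. The list `b` is `(j₁, l₁), …, (jᵣ, lᵣ)`. -/
def IsJonesNormal {m : ℕ} (w : List (Fin m)) : Prop :=
  ∃ b : List (Fin m × Fin m), b.Pairwise (fun x y => x.1 < y.1 ∧ x.2 < y.2) ∧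
    (∀ x ∈ b, x.2 ≤ x.1) ∧ w = b.flatMap (fun x => descWord x.1 x.2)

/-- The set of words in the generators of `TL_n` that are in Jones normal form. -/
abbrev JonesWord (n : ℕ) : Type := {w : List (Fin (n - 1)) // IsJonesNormal w}

/-- The `2n` marked points: `Sum.inl i` lies on the top line, `Sum.inr i` on the bottom line. -/
abbrev Vertex (n : ℕ) : Type := Fin n ⊕ Fin n

/-- The order of the marked points along the boundary of the strip: the top line from left to
right, then the bottom line from right to left. -/
def Before {n : ℕ} : Vertex n → Vertex n → Prop
  | Sum.inl i, Sum.inl j => i < j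
  | Sum.inl _, Sum.inr _ => True
  | Sum.inr _, Sum.inl _ => False
  | Sum.inr i, Sum.inr j => j < i

/-- An `n`-diagram: a partition of the `2n` marked points into blocks of size two (given as the
involution without fixed points that exchanges the two points of each block) which is planar, that
is, the two points of a block are never separated on the boundary of the strip by the two points of
another block. -/
@[ext]
structure Diagram (n : ℕ) where
  pair : Vertex n → Vertex n
  pair_pair : ∀ v, pair (pair v) = v
  pair_ne : ∀ v, pair v ≠ v
  planar : ∀ u v, ¬ (Before u v ∧ Before v (pair u) ∧ Before (pair u) (pair v))

/-- The vertices of two stacked diagrams: top line, (identified) middle line, bottom line. -/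
abbrev Stack (n : ℕ) : Type := Fin n ⊕ Fin n ⊕ Fin n

/-- The vertices of the upper diagram of a stack. -/
def upper {n : ℕ} : Vertex n → Stack n := Sum.map id Sum.inl

/-- The vertices of the lower diagram of a stack. -/
def lower {n : ℕ} : Vertex n → Stack n := Sum.inr

/-- The vertices of a stack that lie on its top or on its bottom line. -/
def outer {n : ℕ} : Vertex n → Stack n := Sum.map id Sum.inr

/-- The edges of the graph obtained by stacking `d₁` on top of `d₂`. -/
inductive StackEdge {n : ℕ} (d₁ d₂ : Diagram n) : Stack n → Stack n → Prop
  | up (v : Vertex n) : StackEdge d₁ d₂ (upper v) (upper (d₁.pair v))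
  | low (v : Vertex n) : StackEdge d₁ d₂ (lower v) (lower (d₂.pair v))

/-- The connected components of the graph obtained by stacking `d₁` on top of `d₂`. -/
def Comp {n : ℕ} (d₁ d₂ : Diagram n) : Type := Quot (StackEdge d₁ d₂)

/-- The connected component of a vertex. -/
def comp {n : ℕ} (d₁ d₂ : Diagram n) (x : Stack n) : Comp d₁ d₂ := Quot.mk _ x

/-- The loops: the components without vertices on the top or on the bottom line. -/
abbrev Loop {n : ℕ} (d₁ d₂ : Diagram n) : Type :=
  {c : Comp d₁ d₂ // ∀ v, comp d₁ d₂ (outer v) ≠ c}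

/-- The number of loops in the stack of `d₁` on top of `d₂`. -/
noncomputable def loops {n : ℕ} (d₁ d₂ : Diagram n) : ℕ := Nat.card (Loop d₁ d₂)

section Composite

variable {n : ℕ} (d₁ d₂ : Diagram n)

instance : Finite (Comp d₁ d₂) := inferInstanceAs (Finite (Quot _))

theorem comp_upper (v : Vertex n) : comp d₁ d₂ (upper (d₁.pair v)) = comp d₁ d₂ (upper v) :=
  (Quot.sound (StackEdge.up v)).symm

theorem comp_lower (v : Vertex n) : comp d₁ d₂ (lower (d₂.pair v)) = comp d₁ d₂ (lower v) :=
  (Quot.sound (StackEdge.low v)).symm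

theorem sum_eq_zero_of_pair (d : Diagram n) (f : Vertex n → ZMod 2)
    (hf : ∀ v, f (d.pair v) = f v) : ∑ v, f v = 0 := by
  refine Finset.sum_involution (fun v _ => d.pair v) ?_ ?_ ?_ ?_
  · intro v _; rw [hf]; exact CharTwo.add_self_eq_zero _
  · intro v _ _; exact d.pair_ne v
  · intro v _; exact Finset.mem_univ _
  · intro v _; exact d.pair_pair v

/-- Two involutions: a class of the generated equivalence relation that contains a fixed point of
one of them contains at most one other fixed point. -/
theorem exists_end {V : Type*} (α β : V → V) (hα : Function.Involutive α)
    (hβ : Function.Involutive β) (u : V) (hu : β u = u) :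
    ∃ e, ∀ v, (α v = v ∨ β v = v) →
      (∀ S : Set V, u ∈ S → (∀ x ∈ S, α x ∈ S ∧ β x ∈ S) → v ∈ S) → v = u ∨ v = e := by
  classical
  let s : ℕ → V → V := fun i => if Even i then α else β
  obtain ⟨x, x0, xs⟩ : ∃ x : ℕ → V, x 0 = u ∧ ∀ i, x (i + 1) = s i (x i) :=
    ⟨fun i => Nat.rec (motive := fun _ => V) u (fun i y => s i y) i, rfl, fun _ => rfl⟩
  have sinv : ∀ i y, s i (s i y) = y := by
    intro i y; by_cases h : Even i <;> simp [s, h, hα y, hβ y]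
  have back : ∀ i, s i (x (i + 1)) = x i := by intro i; rw [xs, sinv]
  have ab : ∀ i y, (α y = s i y ∧ β y = s (i + 1) y) ∨ (β y = s i y ∧ α y = s (i + 1) y) := by
    intro i y; by_cases h : Even i <;> simp [s, h, Nat.even_add_one]
  -- a set of vertices on the walk that is closed
  have key : ∀ (I : Set ℕ), 0 ∈ I → (∀ i, i + 1 ∈ I → i ∈ I) →
      (∀ i ∈ I, i + 1 ∈ I ∨ x (i + 1) = x i) →
      ∀ v, (∀ S : Set V, u ∈ S → (∀ x ∈ S, α x ∈ S ∧ β x ∈ S) → v ∈ S) → ∃ i ∈ I, v = x i := by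
    intro I h0 hd hs v hv
    refine hv {v | ∃ i ∈ I, v = x i} ⟨0, h0, x0.symm⟩ ?_
    rintro _ ⟨i, hi, rfl⟩
    have hup : ∃ j ∈ I, s i (x i) = x j := by
      rcases hs i hi with h | h
      · exact ⟨i + 1, h, (xs i).symm⟩
      · exact ⟨i, hi, by rw [← xs, h]⟩
    rcases i with _ | i
    · refine ⟨?_, 0, h0, by rw [x0, hu]⟩
      simpa [s] using hup
    · have hdn : ∃ j ∈ I, s i (x (i + 1)) = x j := ⟨i, hd i hi, back i⟩
      rcases ab i (x (i + 1)) with ⟨h1, h2⟩ | ⟨h1, h2⟩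
      · exact ⟨by simpa only [Set.mem_ofPred_eq, h1] using hdn,
          by simpa only [Set.mem_ofPred_eq, h2] using hup⟩
      · exact ⟨by simpa only [Set.mem_ofPred_eq, h2] using hup,
          by simpa only [Set.mem_ofPred_eq, h1] using hdn⟩
  have fixed : ∀ i, (α (x (i + 1)) = x (i + 1) ∨ β (x (i + 1)) = x (i + 1)) →
      x (i + 1) = x i ∨ x (i + 2) = x (i + 1) := by
    intro i h
    have e1 := back i
    have e2 := xs (i + 1)
    rcases ab i (x (i + 1)) with ⟨h1, h2⟩ | ⟨h1, h2⟩ <;> rcases h with h | h <;> grind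
  rcases Classical.em (∃ i : ℕ, x (i + 1) = x i) with hk | hk
  · let m := Nat.find (p := fun i => x (i + 1) = x i) hk
    have hm : x (m + 1) = x m := Nat.find_spec hk
    have hlt : ∀ i < m, x (i + 1) ≠ x i := fun i hi => Nat.find_min hk hi
    refine ⟨x m, fun v hv hS => ?_⟩
    obtain ⟨i, hi, rfl⟩ := key {i | i ≤ m} (Nat.zero_le _)
      (fun i hi => by simp only [Set.mem_ofPred_eq] at *; omega)
      (fun i hi => by
        simp only [Set.mem_ofPred_eq] at *
        rcases Nat.lt_or_ge i m with h | h
        · exact Or.inl h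
        · right; rw [show i = m by omega]; exact hm) v hS
    simp only [Set.mem_ofPred_eq] at hi
    rcases i with _ | i
    · exact Or.inl x0
    · rcases fixed i hv with h | h
      · exact absurd h (hlt i (by omega))
      · right
        rcases Nat.lt_or_ge (i + 1) m with h' | h'
        · exact absurd h (hlt _ h')
        · rw [show i + 1 = m by omega]
  · push Not at hk
    refine ⟨u, fun v hv hS => ?_⟩
    obtain ⟨i, -, rfl⟩ := key Set.univ trivial (fun _ _ => trivial) (fun _ _ => Or.inl trivial) v hS
    rcases i with _ | i
    · exact Or.inl x0
    · rcases fixed i hv with h | h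
      · exact absurd h (hk i)
      · exact absurd h (hk _)

theorem closed_of_comp_eq {x y : Stack n} (h : comp d₁ d₂ x = comp d₁ d₂ y) (S : Set (Stack n))
    (hx : x ∈ S) (h1 : ∀ v, upper v ∈ S → upper (d₁.pair v) ∈ S)
    (h2 : ∀ v, lower v ∈ S → lower (d₂.pair v) ∈ S) : y ∈ S := by
  let f : Comp d₁ d₂ → Prop := Quot.lift (fun x => x ∈ S) (by
    rintro _ _ (v | v)
    · refine propext ⟨h1 v, fun h => ?_⟩
      simpa [d₁.pair_pair] using h1 _ h
    · refine propext ⟨h2 v, fun h => ?_⟩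
      simpa [d₂.pair_pair] using h2 _ h)
  have : f (comp d₁ d₂ x) := hx
  rw [h] at this
  exact this

open Classical in
theorem sum_outer (c : Comp d₁ d₂) (f : Stack n → ZMod 2)
    (hf : f = fun x => if comp d₁ d₂ x = c then 1 else 0) : ∑ v, f (outer v) = 0 := by
  have h1 := sum_eq_zero_of_pair d₁ (fun v => f (upper v)) (by
    intro v; simp only [hf, comp_upper])
  have h2 := sum_eq_zero_of_pair d₂ (fun v => f (lower v)) (by
    intro v; simp only [hf, comp_lower])
  simp only [Fintype.sum_sum_type, upper, lower, outer, Sum.map_inl, Sum.map_inr, id] at h1 h2 ⊢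
  have h4 := CharTwo.add_self_eq_zero (∑ x : Fin n, f (Sum.inr (Sum.inl x)))
  linear_combination h1 + h2 - h4

/-- An outer vertex is connected in the stack with exactly one other outer vertex. -/
theorem existsUnique_partner (u : Vertex n) :
    ∃! v, v ≠ u ∧ comp d₁ d₂ (outer v) = comp d₁ d₂ (outer u) := by
  classical
  have hex : ∃ v, v ≠ u ∧ comp d₁ d₂ (outer v) = comp d₁ d₂ (outer u) := by
    by_contra! hno
    have := sum_outer d₁ d₂ (comp d₁ d₂ (outer u)) _ rfl
    rw [Finset.sum_eq_single u] at this
    · simp at this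
    · intro v _ hv; simp [hno v hv]
    · simp
  let α : Stack n → Stack n := Sum.elim (fun i => upper (d₁.pair (Sum.inl i)))
    (Sum.elim (fun i => upper (d₁.pair (Sum.inr i))) (fun i => Sum.inr (Sum.inr i)))
  let β : Stack n → Stack n := Sum.elim (fun i => Sum.inl i) (fun v => lower (d₂.pair v))
  have αu : ∀ v, α (upper v) = upper (d₁.pair v) := by rintro (i | i) <;> rfl
  have αb : ∀ i, α (Sum.inr (Sum.inr i)) = Sum.inr (Sum.inr i) := fun _ => rfl
  have βl : ∀ v, β (lower v) = lower (d₂.pair v) := fun v => rfl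
  have βt : ∀ i, β (Sum.inl i) = Sum.inl i := fun _ => rfl
  have hα : Function.Involutive α := by
    rintro (i | i | i)
    · change α (α (upper (Sum.inl i))) = upper (Sum.inl i)
      rw [αu, αu, d₁.pair_pair]
    · change α (α (upper (Sum.inr i))) = upper (Sum.inr i)
      rw [αu, αu, d₁.pair_pair]
    · rfl
  have hβ : Function.Involutive β := by
    rintro (i | v)
    · rfl
    · change β (β (lower v)) = lower v
      rw [βl, βl, d₂.pair_pair]
  have main : ∃ e, ∀ v : Vertex n, comp d₁ d₂ (outer v) = comp d₁ d₂ (outer u) →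
      outer v = outer u ∨ outer v = e := by
    have hfix : ∀ v : Vertex n, α (outer v) = outer v ∨ β (outer v) = outer v := by
      rintro (i | i)
      · exact Or.inr rfl
      · exact Or.inl rfl
    have hcl : ∀ v : Vertex n, comp d₁ d₂ (outer v) = comp d₁ d₂ (outer u) →
        ∀ S : Set (Stack n), outer u ∈ S → (∀ x ∈ S, α x ∈ S ∧ β x ∈ S) → outer v ∈ S := by
      intro v hv S hu hS
      refine closed_of_comp_eq d₁ d₂ hv.symm S hu (fun w hw => ?_) (fun w hw => ?_)
      · rw [← αu]; exact (hS _ hw).1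
      · rw [← βl]; exact (hS _ hw).2
    rcases hfix u with h | h
    · obtain ⟨e, he⟩ := exists_end β α hβ hα (outer u) h
      exact ⟨e, fun v hv => he _ (hfix v).symm
        (fun S h1 h2 => hcl v hv S h1 (fun x hx => (h2 x hx).symm))⟩
    · obtain ⟨e, he⟩ := exists_end α β hα hβ (outer u) h
      exact ⟨e, fun v hv => he _ (hfix v) (hcl v hv)⟩
  have hinj : Function.Injective (outer : Vertex n → Stack n) := by
    rintro (i | i) (j | j) h <;> simp_all [outer]
  obtain ⟨e, he⟩ := main
  obtain ⟨v, hv, hc⟩ := hex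
  refine ⟨v, ⟨hv, hc⟩, fun w hw => hinj ?_⟩
  have h1 := (he v hc).resolve_left (fun h => hv (hinj h))
  have h2 := (he w hw.2).resolve_left (fun h => hw.1 (hinj h))
  rw [h1, h2]


open Classical in
/-- The indicator function of `Before`, with values modulo two. -/
noncomputable def before {n : ℕ} (u v : Vertex n) : ZMod 2 := if Before u v then 1 else 0

theorem exists_pos (n : ℕ) : ∃ pos : Vertex n → ℕ, Function.Injective pos ∧
    ∀ u v, Before u v ↔ pos u < pos v := by
  refine ⟨Sum.elim (fun i => i) (fun i => 2 * n - i), ?_, ?_⟩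
  · rintro (i | i) (j | j) h <;> simp only [Sum.elim_inl, Sum.elim_inr] at h <;>
      simp only [Sum.inl.injEq, Sum.inr.injEq, reduceCtorEq] <;> omega
  · rintro (i | i) (j | j) <;> simp only [Before, Sum.elim_inl, Sum.elim_inr, true_iff, false_iff, Fin.lt_def] <;> omega

theorem nat_chord {a a' b b' : ℕ} (h1 : a < a') (h2 : b < b') (h3 : b ≠ a) (h4 : b ≠ a')
    (h5 : b' ≠ a) (h6 : b' ≠ a') (h7 : ¬ (a < b ∧ b < a' ∧ a' < b'))
    (h8 : ¬ (b < a ∧ a < b' ∧ b' < a')) :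
    (if a < b then 1 else 0 : ZMod 2) + (if a' < b then 1 else 0) =
      (if a < b' then 1 else 0) + (if a' < b' then 1 else 0) := by
  split_ifs <;> first | rfl | (exfalso; omega)

theorem chord (d : Diagram n) (p q : Vertex n) (h1 : q ≠ p) (h2 : q ≠ d.pair p) :
    before p q + before (d.pair p) q = before p (d.pair q) + before (d.pair p) (d.pair q) := by
  obtain ⟨pos, hi, hb⟩ := exists_pos n
  have h3 : d.pair q ≠ p := fun h => h2 (by rw [← h, d.pair_pair])
  have h4 : d.pair q ≠ d.pair p := fun h => h1 (by rw [← d.pair_pair q, h, d.pair_pair])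
  have n1 := hi.ne h1
  have n2 := hi.ne h2
  have n3 := hi.ne h3
  have n4 := hi.ne h4
  have k : ∀ u v, ¬ (pos u < pos v ∧ pos v < pos (d.pair u) ∧
      pos (d.pair u) < pos (d.pair v)) := by
    simpa only [hb] using d.planar
  have kp := fun v => k (d.pair p) v
  have kq := fun u => k u (d.pair q)
  have kr := k (d.pair p) (d.pair q)
  have kq' := fun u => k (d.pair q) u
  have kr' := k (d.pair q) (d.pair p)
  simp only [d.pair_pair] at kp kq kr kq' kr'
  simp only [before, hb]
  rcases lt_or_gt_of_ne (hi.ne (d.pair_ne p)) with hp | hp <;>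
    rcases lt_or_gt_of_ne (hi.ne (d.pair_ne q)) with hq | hq
  · have := nat_chord hp hq n4 n3 n2 n1 kr kr'
    linear_combination -this
  · have := nat_chord hp hq n2 n1 n4 n3 (kp q) (by simpa only [d.pair_pair] using k q (d.pair p))
    linear_combination this
  · have := nat_chord hp hq n3 n4 n1 n2 (kq p) (kq' p)
    linear_combination -this
  · exact nat_chord hp hq n1 n2 n3 n4 (k p q) (k q p)

theorem sum_chords (d : Diagram n) (P Q : Vertex n → ZMod 2) (hP : ∀ v, P (d.pair v) = P v)
    (hQ : ∀ v, Q (d.pair v) = Q v) (hPQ : ∀ v, P v * Q v = 0) :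
    ∑ p, ∑ q, P p * Q q * before p q = 0 := by
  refine sum_eq_zero_of_pair d _ fun p => ?_
  have h := sum_eq_zero_of_pair d
    (fun q => P p * Q q * (before p q + before (d.pair p) q)) (fun q => ?_)
  · have h' : ∑ q, P p * Q q * before p q + ∑ q, P p * Q q * before (d.pair p) q = 0 := by
      rw [← h, ← Finset.sum_add_distrib]
      exact Finset.sum_congr rfl fun q _ => by ring
    simp only [hP]
    exact (CharTwo.add_eq_zero.mp h').symm
  · rw [hQ]
    by_cases h1 : q = p
    · rw [h1, hPQ, zero_mul, zero_mul]
    · by_cases h2 : q = d.pair p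
      · rw [h2, hQ, hPQ, zero_mul, zero_mul]
      · rw [chord d p q h1 h2]

theorem before_swap {n : ℕ} {i j : Fin n} (h : i ≠ j) :
    before (Sum.inl i : Vertex n) (Sum.inl j) + before (Sum.inr i : Vertex n) (Sum.inr j) = 1 := by
  have h' := Fin.val_ne_of_ne h
  simp only [before, Before, Fin.lt_def]
  split_ifs <;> first | rfl | (exfalso; omega)

/-- Two disjoint unions of components cross an even number of times. -/
theorem sum_stack (f g : Stack n → ZMod 2)
    (f1 : ∀ v, f (upper (d₁.pair v)) = f (upper v)) (f2 : ∀ v, f (lower (d₂.pair v)) = f (lower v))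
    (g1 : ∀ v, g (upper (d₁.pair v)) = g (upper v)) (g2 : ∀ v, g (lower (d₂.pair v)) = g (lower v))
    (hfg : ∀ x, f x * g x = 0) :
    ∑ p, ∑ q, f (outer p) * g (outer q) * before p q = 0 := by
  have e1 := sum_chords d₁ (fun v => f (upper v)) (fun v => g (upper v)) f1 g1 (fun v => hfg _)
  have e2 := sum_chords d₂ (fun v => f (lower v)) (fun v => g (lower v)) f2 g2 (fun v => hfg _)
  have e3 := sum_eq_zero_of_pair d₁ (fun v => f (upper v)) f1
  have e4 := sum_eq_zero_of_pair d₂ (fun v => f (lower v)) f2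
  have e5 := sum_eq_zero_of_pair d₁ (fun v => g (upper v)) g1
  have e6 := sum_eq_zero_of_pair d₂ (fun v => g (lower v)) g2
  have b1 : ∀ i j : Fin n, before (Sum.inl i : Vertex n) (Sum.inr j) = 1 := fun i j => by
    simp [before, Before]
  have b2 : ∀ i j : Fin n, before (Sum.inr i : Vertex n) (Sum.inl j) = 0 := fun i j => by
    simp [before, Before]
  have e7 : ∑ i : Fin n, ∑ j : Fin n, f (Sum.inr (Sum.inl i)) * g (Sum.inr (Sum.inl j)) *
      before (Sum.inr i : Vertex n) (Sum.inr j) +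
      ∑ i : Fin n, ∑ j : Fin n, f (Sum.inr (Sum.inl i)) * g (Sum.inr (Sum.inl j)) *
      before (Sum.inl i : Vertex n) (Sum.inl j) =
      (∑ i, f (Sum.inr (Sum.inl i))) * ∑ j, g (Sum.inr (Sum.inl j)) := by
    rw [Finset.sum_mul_sum, ← Finset.sum_add_distrib]
    refine Finset.sum_congr rfl fun i _ => ?_
    rw [← Finset.sum_add_distrib]
    refine Finset.sum_congr rfl fun j _ => ?_
    by_cases h : i = j
    · rw [h, hfg]; ring
    · rw [← mul_add, add_comm (before _ _), before_swap h, mul_one]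
  simp only [Fintype.sum_sum_type, upper, lower, outer, Sum.map_inl, Sum.map_inr, id, b1, b2,
    mul_one, mul_zero, Finset.sum_const_zero, Finset.sum_add_distrib,
    ← Finset.mul_sum, ← Finset.sum_mul] at e1 e2 e3 e4 e5 e6 ⊢
  have t : (2 : ZMod 2) = 0 := rfl
  generalize (∑ i : Fin n, ∑ j : Fin n, f (Sum.inr (Sum.inl i)) * g (Sum.inr (Sum.inl j)) *
      before (Sum.inr i : Vertex n) (Sum.inr j)) = A at *
  generalize (∑ i : Fin n, ∑ j : Fin n, f (Sum.inr (Sum.inl i)) * g (Sum.inr (Sum.inl j)) *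
      before (Sum.inl i : Vertex n) (Sum.inl j)) = B at *
  generalize (∑ i : Fin n, f (Sum.inl i)) = Ft at *
  generalize (∑ i : Fin n, f (Sum.inr (Sum.inl i))) = Fm at *
  generalize (∑ i : Fin n, f (Sum.inr (Sum.inr i))) = Fb at *
  generalize (∑ i : Fin n, g (Sum.inl i)) = Gt at *
  generalize (∑ i : Fin n, g (Sum.inr (Sum.inl i))) = Gm at *
  generalize (∑ i : Fin n, g (Sum.inr (Sum.inr i))) = Gb at *
  have c1 : Ft = Fm := CharTwo.add_eq_zero.mp e3
  have c2 : Fm = Fb := CharTwo.add_eq_zero.mp e4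
  have c3 : Gt = Gm := CharTwo.add_eq_zero.mp e5
  have c4 : Gm = Gb := CharTwo.add_eq_zero.mp e6
  subst c1 c2 c3 c4
  linear_combination e1 + e2 - e7 - t * Ft * Gt

/-- The diagram obtained from the stack of `d₁` on top of `d₂` by removing the middle line: two
marked points form a block if and only if they are connected in the stack. -/
noncomputable def Diagram.stack (d₁ d₂ : Diagram n) : Diagram n where
  pair u := (existsUnique_partner d₁ d₂ u).choose
  pair_pair u := by
    have h1 := (existsUnique_partner d₁ d₂ u).choose_spec.1
    exact (((existsUnique_partner d₁ d₂ _).choose_spec.2) u ⟨h1.1.symm, h1.2.symm⟩).symm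
  pair_ne u := (existsUnique_partner d₁ d₂ u).choose_spec.1.1
  planar u v := by
    classical
    rintro ⟨h1, h2, h3⟩
    have hu := (existsUnique_partner d₁ d₂ u).choose_spec
    have hv := (existsUnique_partner d₁ d₂ v).choose_spec
    set u' := (existsUnique_partner d₁ d₂ u).choose
    set v' := (existsUnique_partner d₁ d₂ v).choose
    obtain ⟨pos, hi, hb⟩ := exists_pos n
    rw [hb] at h1 h2 h3
    have hne : comp d₁ d₂ (outer u) ≠ comp d₁ d₂ (outer v) := by
      intro h
      have := hu.2 v ⟨by rintro rfl; omega, h.symm⟩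
      rw [this] at h2
      omega
    have key := sum_stack d₁ d₂
      (fun x => if comp d₁ d₂ x = comp d₁ d₂ (outer u) then 1 else 0)
      (fun x => if comp d₁ d₂ x = comp d₁ d₂ (outer v) then 1 else 0)
      (fun w => by simp only [comp_upper]) (fun w => by simp only [comp_lower])
      (fun w => by simp only [comp_upper]) (fun w => by simp only [comp_lower])
      (fun x => by
        split_ifs with h4 h5
        · exact absurd (h4.symm.trans h5) hne
        all_goals simp)
    have red : ∀ (w w' : Vertex n) (F : Vertex n → ZMod 2),
        (w' ≠ w ∧ comp d₁ d₂ (outer w') = comp d₁ d₂ (outer w)) ∧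
        (∀ y, y ≠ w ∧ comp d₁ d₂ (outer y) = comp d₁ d₂ (outer w) → y = w') →
        ∑ p, (if comp d₁ d₂ (outer p) = comp d₁ d₂ (outer w) then 1 else 0) * F p =
          F w + F w' := by
      intro w w' F h
      rw [← Finset.sum_pair h.1.1.symm]
      simp only [ite_mul, one_mul, zero_mul]
      rw [← Finset.sum_filter]
      refine Finset.sum_congr ?_ fun _ _ => rfl
      ext y
      simp only [Finset.mem_filter, Finset.mem_univ, true_and, Finset.mem_insert,
        Finset.mem_singleton]
      constructor
      · intro hy
        by_cases hyw : y = w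
        · exact Or.inl hyw
        · exact Or.inr (h.2 y ⟨hyw, hy⟩)
      · rintro (rfl | rfl)
        · rfl
        · exact h.1.2
    simp only [mul_assoc, ← Finset.mul_sum] at key
    rw [red u u' _ hu, red v v' _ hv, red v v' _ hv] at key
    simp only [before, hb] at key
    rw [if_pos h1, if_pos (by omega), if_neg (by omega), if_pos h3] at key
    exact absurd key (by decide)

theorem comp_outer_eq_iff (u v : Vertex n) :
    comp d₁ d₂ (outer v) = comp d₁ d₂ (outer u) ↔ v = u ∨ v = (d₁.stack d₂).pair u := by
  have h := (existsUnique_partner d₁ d₂ u).choose_spec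
  constructor
  · intro hv
    by_cases hvu : v = u
    · exact Or.inl hvu
    · exact Or.inr (h.2 v ⟨hvu, hv⟩)
  · rintro (rfl | rfl)
    · rfl
    · exact h.1.2

theorem stack_pair_eq {u v : Vertex n} (hv : v ≠ u)
    (h : comp d₁ d₂ (outer v) = comp d₁ d₂ (outer u)) : (d₁.stack d₂).pair u = v :=
  (((comp_outer_eq_iff d₁ d₂ u v).mp h).resolve_left hv).symm

end Composite

section Assoc

variable {n : ℕ} (d₁ d₂ d₃ : Diagram n)

/-- The edges of the graph obtained by stacking three diagrams. -/
inductive StackEdge₃ : Fin n ⊕ Stack n → Fin n ⊕ Stack n → Prop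
  | fst (v : Vertex n) : StackEdge₃ (Sum.map id Sum.inl v) (Sum.map id Sum.inl (d₁.pair v))
  | snd (v : Vertex n) : StackEdge₃ (Sum.inr (upper v)) (Sum.inr (upper (d₂.pair v)))
  | thd (v : Vertex n) : StackEdge₃ (Sum.inr (lower v)) (Sum.inr (lower (d₃.pair v)))

/-- The vertices on the top or on the bottom line of a stack of three diagrams. -/
def outer₃ {n : ℕ} : Vertex n → Fin n ⊕ Stack n := Sum.map id (fun i => Sum.inr (Sum.inr i))

theorem exists_equiv_left : ∃ e : Quot (StackEdge₃ d₁ d₂ d₃) ≃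
    Comp (d₁.stack d₂) d₃ ⊕ Loop d₁ d₂,
    ∀ v, e (Quot.mk _ (outer₃ v)) = Sum.inl (comp _ _ (outer v)) := by
  classical
  let r := StackEdge₃ d₁ d₂ d₃
  let G : Comp d₁ d₂ → Comp (d₁.stack d₂) d₃ ⊕ Loop d₁ d₂ := fun c =>
    if h : ∃ v, comp d₁ d₂ (outer v) = c then Sum.inl (comp _ _ (upper h.choose))
    else Sum.inr ⟨c, fun v hv => h ⟨v, hv⟩⟩
  have G1 : ∀ v, G (comp d₁ d₂ (outer v)) = Sum.inl (comp _ _ (upper v)) := by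
    intro v
    have h : ∃ w, comp d₁ d₂ (outer w) = comp d₁ d₂ (outer v) := ⟨v, rfl⟩
    simp only [G, dif_pos h, Sum.inl.injEq]
    rcases (comp_outer_eq_iff d₁ d₂ v _).mp h.choose_spec with h' | h'
    · rw [h']
    · rw [h', comp_upper]
  have G2 : ∀ c : Loop d₁ d₂, G c.1 = Sum.inr c := by
    intro c
    have h : ¬ ∃ w, comp d₁ d₂ (outer w) = c.1 := fun ⟨w, hw⟩ => c.2 w hw
    exact dif_neg h
  let F : Fin n ⊕ Stack n → Comp (d₁.stack d₂) d₃ ⊕ Loop d₁ d₂ :=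
    Sum.elim (fun i => G (comp _ _ (Sum.inl i)))
      (Sum.elim (fun i => G (comp _ _ (Sum.inr (Sum.inl i))))
      (Sum.elim (fun i => G (comp _ _ (Sum.inr (Sum.inr i))))
        (fun i => Sum.inl (comp _ _ (Sum.inr (Sum.inr i))))))
  let i : Stack n → Fin n ⊕ Stack n := Sum.map id (Sum.map id Sum.inl)
  let s : Stack n → Fin n ⊕ Stack n := Sum.map id Sum.inr
  have Fi : ∀ x, F (i x) = G (comp _ _ x) := by rintro (x | x | x) <;> rfl
  have Fs : ∀ x, F (s x) = Sum.inl (comp _ _ x) := by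
    rintro (x | x | x)
    · exact G1 (Sum.inl x)
    · exact G1 (Sum.inr x)
    · rfl
  have F1 : ∀ a b, r a b → F a = F b := by
    rintro _ _ (v | v | v)
    · have h : ∀ v : Vertex n, (Sum.map id Sum.inl v : Fin n ⊕ Stack n) = i (upper v) := by
        rintro (v | v) <;> rfl
      rw [h, h, Fi, Fi, comp_upper]
    · have h : ∀ v : Vertex n, (Sum.inr (upper v) : Fin n ⊕ Stack n) = i (lower v) := by
        rintro (v | v) <;> rfl
      rw [h, h, Fi, Fi, comp_lower]
    · have h : ∀ v : Vertex n, (Sum.inr (lower v) : Fin n ⊕ Stack n) = s (lower v) := by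
        rintro (v | v) <;> rfl
      rw [h, h, Fs, Fs, comp_lower]
  let I : Comp d₁ d₂ → Quot r := Quot.lift (fun x => Quot.mk r (i x)) (by
    rintro _ _ (v | v)
    · convert (Quot.sound (StackEdge₃.fst v) : Quot.mk r _ = Quot.mk r _) using 2
      · rcases v with v | v <;> rfl
      · rcases d₁.pair v with v | v <;> rfl
    · convert (Quot.sound (StackEdge₃.snd v) : Quot.mk r _ = Quot.mk r _) using 2
      · rcases v with v | v <;> rfl
      · rcases d₂.pair v with v | v <;> rfl)
  have I1 : ∀ x, I (comp _ _ x) = Quot.mk r (i x) := fun x => rfl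
  let S : Comp (d₁.stack d₂) d₃ → Quot r := Quot.lift (fun x => Quot.mk r (s x)) (by
    rintro _ _ (v | v)
    · have h : ∀ v : Vertex n, Quot.mk r (s (upper v)) = I (comp _ _ (outer v)) := by
        rintro (v | v) <;> rfl
      rw [h, h, (comp_outer_eq_iff d₁ d₂ v _).mpr (Or.inr rfl)]
    · exact Quot.sound (StackEdge₃.thd v))
  have S1 : ∀ x, S (comp _ _ x) = Quot.mk r (s x) := fun x => rfl
  have hG : ∀ c, Sum.elim S (fun c : Loop d₁ d₂ => I c.1) (G c) = I c := by
    intro c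
    by_cases h : ∃ v, comp d₁ d₂ (outer v) = c
    · obtain ⟨v, rfl⟩ := h
      rw [G1]
      rcases v with v | v <;> rfl
    · rw [show G c = Sum.inr ⟨c, fun v hv => h ⟨v, hv⟩⟩ from dif_neg h, Sum.elim_inr]
  refine ⟨⟨Quot.lift F F1, Sum.elim S (fun c => I c.1), ?_, ?_⟩, ?_⟩
  · rintro ⟨x | x | x | x⟩
    · exact hG _
    · exact hG _
    · exact hG _
    · rfl
  · rintro (c | ⟨c, h⟩) <;> obtain ⟨x, rfl⟩ := Quot.exists_rep c
    · exact Fs x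
    · exact (Fi x).trans (G2 ⟨_, h⟩)
  · rintro (v | v)
    · exact G1 (Sum.inl v)
    · rfl

theorem exists_equiv_right : ∃ e : Quot (StackEdge₃ d₁ d₂ d₃) ≃
    Comp d₁ (d₂.stack d₃) ⊕ Loop d₂ d₃,
    ∀ v, e (Quot.mk _ (outer₃ v)) = Sum.inl (comp _ _ (outer v)) := by
  classical
  let r := StackEdge₃ d₁ d₂ d₃
  let G : Comp d₂ d₃ → Comp d₁ (d₂.stack d₃) ⊕ Loop d₂ d₃ := fun c =>
    if h : ∃ v, comp d₂ d₃ (outer v) = c then Sum.inl (comp _ _ (lower h.choose))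
    else Sum.inr ⟨c, fun v hv => h ⟨v, hv⟩⟩
  have G1 : ∀ v, G (comp d₂ d₃ (outer v)) = Sum.inl (comp _ _ (lower v)) := by
    intro v
    have h : ∃ w, comp d₂ d₃ (outer w) = comp d₂ d₃ (outer v) := ⟨v, rfl⟩
    simp only [G, dif_pos h, Sum.inl.injEq]
    rcases (comp_outer_eq_iff d₂ d₃ v _).mp h.choose_spec with h' | h'
    · rw [h']
    · rw [h', comp_lower]
  have G2 : ∀ c : Loop d₂ d₃, G c.1 = Sum.inr c := by
    intro c
    have h : ¬ ∃ w, comp d₂ d₃ (outer w) = c.1 := fun ⟨w, hw⟩ => c.2 w hw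
    exact dif_neg h
  let F : Fin n ⊕ Stack n → Comp d₁ (d₂.stack d₃) ⊕ Loop d₂ d₃ :=
    Sum.elim (fun i => Sum.inl (comp _ _ (Sum.inl i))) (fun x => G (comp _ _ x))
  let s : Stack n → Fin n ⊕ Stack n := Sum.map id (Sum.map id Sum.inr)
  have Fs : ∀ x, F (s x) = Sum.inl (comp _ _ x) := by
    rintro (x | x | x)
    · rfl
    · exact G1 (Sum.inl x)
    · exact G1 (Sum.inr x)
  have F1 : ∀ a b, r a b → F a = F b := by
    rintro _ _ (v | v | v)
    · have h : ∀ v : Vertex n, (Sum.map id Sum.inl v : Fin n ⊕ Stack n) = s (upper v) := by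
        rintro (v | v) <;> rfl
      rw [h, h, Fs, Fs, comp_upper]
    · exact congrArg G (comp_upper d₂ d₃ v).symm
    · exact congrArg G (comp_lower d₂ d₃ v).symm
  let I : Comp d₂ d₃ → Quot r := Quot.lift (fun x => Quot.mk r (Sum.inr x)) (by
    rintro _ _ (v | v)
    · exact Quot.sound (StackEdge₃.snd v)
    · exact Quot.sound (StackEdge₃.thd v))
  let S : Comp d₁ (d₂.stack d₃) → Quot r := Quot.lift (fun x => Quot.mk r (s x)) (by
    rintro _ _ (v | v)
    · convert (Quot.sound (StackEdge₃.fst v) : Quot.mk r _ = Quot.mk r _) using 2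
      · rcases v with v | v <;> rfl
      · rcases d₁.pair v with v | v <;> rfl
    · have h : ∀ v : Vertex n, Quot.mk r (s (lower v)) = I (comp _ _ (outer v)) := by
        rintro (v | v) <;> rfl
      rw [h, h, (comp_outer_eq_iff d₂ d₃ v _).mpr (Or.inr rfl)])
  have hG : ∀ c, Sum.elim S (fun c : Loop d₂ d₃ => I c.1) (G c) = I c := by
    intro c
    by_cases h : ∃ v, comp d₂ d₃ (outer v) = c
    · obtain ⟨v, rfl⟩ := h
      rw [G1]
      rcases v with v | v <;> rfl
    · rw [show G c = Sum.inr ⟨c, fun v hv => h ⟨v, hv⟩⟩ from dif_neg h, Sum.elim_inr]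
  refine ⟨⟨Quot.lift F F1, Sum.elim S (fun c => I c.1), ?_, ?_⟩, ?_⟩
  · rintro ⟨x | x⟩
    · rfl
    · exact hG _
  · rintro (c | ⟨c, h⟩) <;> obtain ⟨x, rfl⟩ := Quot.exists_rep c
    · exact Fs x
    · exact G2 ⟨_, h⟩
  · rintro (v | v)
    · rfl
    · exact G1 (Sum.inr v)

theorem card_closed {A B L : Type} [Finite A] [Finite L] (o : Vertex n → B) (a : Vertex n → A)
    (e : B ≃ A ⊕ L) (he : ∀ v, e (o v) = Sum.inl (a v)) :
    Nat.card {c : B // ∀ v, o v ≠ c} = Nat.card L + Nat.card {c : A // ∀ v, a v ≠ c} := by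
  have e1 : {c : B // ∀ v, o v ≠ c} ≃ {c : A ⊕ L // ∀ v, Sum.inl (a v) ≠ c} :=
    e.subtypeEquiv (fun c => forall_congr' fun v => by rw [← he, e.injective.ne_iff])
  rw [Nat.card_congr e1, Nat.card_congr Equiv.subtypeSum, Nat.card_sum, add_comm]
  congr 1
  · exact Nat.card_congr (Equiv.subtypeUnivEquiv (by simp))
  · exact Nat.card_congr (Equiv.subtypeEquivRight (by simp))

theorem loops_assoc :
    loops d₁ d₂ + loops (d₁.stack d₂) d₃ = loops d₂ d₃ + loops d₁ (d₂.stack d₃) := by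
  obtain ⟨e, he⟩ := exists_equiv_left d₁ d₂ d₃
  obtain ⟨f, hf⟩ := exists_equiv_right d₁ d₂ d₃
  exact (card_closed _ _ e he).symm.trans (card_closed _ _ f hf)

theorem stack_assoc : (d₁.stack d₂).stack d₃ = d₁.stack (d₂.stack d₃) := by
  obtain ⟨e, he⟩ := exists_equiv_left d₁ d₂ d₃
  obtain ⟨f, hf⟩ := exists_equiv_right d₁ d₂ d₃
  ext1
  funext u
  refine stack_pair_eq _ _ (Diagram.pair_ne _ _) ?_
  have h := (comp_outer_eq_iff d₁ (d₂.stack d₃) u _).mpr (Or.inr rfl)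
  rw [← Sum.inl_injective.eq_iff, ← hf, ← hf, f.injective.eq_iff] at h
  rw [← Sum.inl_injective.eq_iff, ← he, ← he, h]

end Assoc

section Generators

variable {n : ℕ}

/-- The identity diagram: each top point is joined to the bottom point below it. -/
def Diagram.one (n : ℕ) : Diagram n where
  pair := Sum.swap
  pair_pair := Sum.swap_swap
  pair_ne := by rintro (i | i) <;> simp
  planar := by
    rintro (i | i) (j | j) ⟨h1, h2, h3⟩ <;>
      simp only [Sum.swap_inl, Sum.swap_inr, Before, Fin.lt_def] at h1 h2 h3 <;> omega

/-- The diagram in which the points `i` and `i + 1` are joined to each other on the top line and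
also on the bottom line, and each other top point is joined to the bottom point below it. -/
def Diagram.gen (i : Fin (n - 1)) : Diagram n where
  pair := fun v =>
    let a : Fin n := ⟨i, by omega⟩
    let b : Fin n := ⟨i + 1, by omega⟩
    match v with
    | Sum.inl j => if j = a then Sum.inl b else if j = b then Sum.inl a else Sum.inr j
    | Sum.inr j => if j = a then Sum.inr b else if j = b then Sum.inr a else Sum.inl j
  pair_pair := by
    rintro (j | j) <;> dsimp only <;> split_ifs <;> simp_all [Fin.ext_iff]
  pair_ne := by
    rintro (j | j) <;> dsimp only <;> split_ifs <;> simp_all [Fin.ext_iff]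
  planar := by
    rintro (j | j) (l | l) <;> dsimp only <;> split_ifs <;> rintro ⟨h1, h2, h3⟩ <;>
      simp only [Before, Fin.lt_def, Fin.ext_iff] at * <;> omega

theorem comp_one_left (d : Diagram n) (i : Fin n) :
    comp (Diagram.one n) d (Sum.inr (Sum.inl i)) = comp (Diagram.one n) d (Sum.inl i) :=
  comp_upper (Diagram.one n) d (Sum.inl i)

theorem comp_one_right (d : Diagram n) (i : Fin n) :
    comp d (Diagram.one n) (Sum.inr (Sum.inl i)) = comp d (Diagram.one n) (Sum.inr (Sum.inr i)) :=
  comp_lower d (Diagram.one n) (Sum.inr i)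

theorem one_stack (d : Diagram n) : (Diagram.one n).stack d = d := by
  ext1
  funext u
  refine stack_pair_eq _ _ (d.pair_ne u) ?_
  have h : ∀ v, comp (Diagram.one n) d (outer v) = comp (Diagram.one n) d (lower v) := by
    rintro (i | i)
    · exact (comp_one_left d i).symm
    · rfl
  rw [h, h, comp_lower]

theorem stack_one (d : Diagram n) : d.stack (Diagram.one n) = d := by
  ext1
  funext u
  refine stack_pair_eq _ _ (d.pair_ne u) ?_
  have h : ∀ v, comp d (Diagram.one n) (outer v) = comp d (Diagram.one n) (upper v) := by
    rintro (i | i)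
    · rfl
    · exact (comp_one_right d i).symm
  rw [h, h, comp_upper]

theorem loops_one_left (d : Diagram n) : loops (Diagram.one n) d = 0 := by
  have : IsEmpty (Loop (Diagram.one n) d) := by
    refine ⟨?_⟩
    rintro ⟨⟨x | x | x⟩, h⟩
    · exact h (Sum.inl x) rfl
    · exact h (Sum.inl x) (comp_one_left d x).symm
    · exact h (Sum.inr x) rfl
  exact Nat.card_of_isEmpty

theorem loops_one_right (d : Diagram n) : loops d (Diagram.one n) = 0 := by
  have : IsEmpty (Loop d (Diagram.one n)) := by
    refine ⟨?_⟩
    rintro ⟨⟨x | x | x⟩, h⟩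
    · exact h (Sum.inl x) rfl
    · exact h (Sum.inr x) (comp_one_right d x).symm
    · exact h (Sum.inr x) rfl
  exact Nat.card_of_isEmpty

end Generators

section Algebra

variable {k : Type*} [CommRing k]

/-- The underlying module of the diagram algebra `D_n(δ)`: the free module on the set of
`n`-diagrams. -/
def DiagramAlgebra (n : ℕ) (_δ : k) : Type _ := Diagram n →₀ k

/-- The multiplication of `D_n(δ)`: the bilinear extension of `d₁ d₂ = δ ^ L • d₃`, where `d₃` is
obtained from the stack of `d₁` on top of `d₂` by removing its `L` loops and its middle line. -/
noncomputable def diagramMul (n : ℕ) (δ : k) :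
    (Diagram n →₀ k) →ₗ[k] (Diagram n →₀ k) →ₗ[k] (Diagram n →₀ k) :=
  Finsupp.lift _ k _ fun d₁ => Finsupp.lift _ k _ fun d₂ =>
    δ ^ loops d₁ d₂ • Finsupp.single (d₁.stack d₂) 1

theorem diagramMul_single (n : ℕ) (δ : k) (d₁ d₂ : Diagram n) (a b : k) :
    diagramMul n δ (Finsupp.single d₁ a) (Finsupp.single d₂ b) =
      Finsupp.single (d₁.stack d₂) (a * b * δ ^ loops d₁ d₂) := by
  simp only [diagramMul, Finsupp.lift_apply]
  rw [Finsupp.sum_single_index (by rw [zero_smul]), LinearMap.smul_apply, Finsupp.lift_apply,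
    Finsupp.sum_single_index (by rw [zero_smul]), Finsupp.smul_single, Finsupp.smul_single,
    Finsupp.smul_single, smul_eq_mul, smul_eq_mul, smul_eq_mul, mul_one, mul_assoc]

theorem diagramMul_assoc (n : ℕ) (δ : k) (x y z : Diagram n →₀ k) :
    diagramMul n δ (diagramMul n δ x y) z = diagramMul n δ x (diagramMul n δ y z) := by
  induction x using Finsupp.induction_linear with
  | zero => simp
  | add _ _ h1 h2 => simp only [map_add, LinearMap.add_apply, h1, h2]
  | single d₁ a =>
    induction y using Finsupp.induction_linear with
    | zero => simp
    | add _ _ h1 h2 => simp only [map_add, LinearMap.add_apply, h1, h2]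
    | single d₂ b =>
      induction z using Finsupp.induction_linear with
      | zero => simp
      | add _ _ h1 h2 => simp only [map_add, h1, h2]
      | single d₃ c =>
        simp only [diagramMul_single, stack_assoc]
        congr 1
        have h := congrArg (δ ^ ·) (loops_assoc d₁ d₂ d₃)
        simp only [pow_add] at h
        linear_combination a * b * c * h

theorem diagramMul_one_left (n : ℕ) (δ : k) (x : Diagram n →₀ k) :
    diagramMul n δ (Finsupp.single (Diagram.one n) 1) x = x := by
  induction x using Finsupp.induction_linear with
  | zero => simp
  | add _ _ h1 h2 => simp only [map_add, h1, h2]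
  | single d a => simp [diagramMul_single, one_stack, loops_one_left]

theorem diagramMul_one_right (n : ℕ) (δ : k) (x : Diagram n →₀ k) :
    diagramMul n δ x (Finsupp.single (Diagram.one n) 1) = x := by
  induction x using Finsupp.induction_linear with
  | zero => simp
  | add _ _ h1 h2 => simp only [map_add, LinearMap.add_apply, h1, h2]
  | single d a => simp [diagramMul_single, stack_one, loops_one_right]

noncomputable instance (n : ℕ) (δ : k) : AddCommGroup (DiagramAlgebra n δ) :=
  inferInstanceAs (AddCommGroup (Diagram n →₀ k))

noncomputable instance (n : ℕ) (δ : k) : Ring (DiagramAlgebra n δ) :=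
  { (inferInstance : AddCommGroup (DiagramAlgebra n δ)) with
    mul := fun x y => diagramMul n δ x y
    one := Finsupp.single (Diagram.one n) 1
    left_distrib := fun x y z => (diagramMul n δ x).map_add y z
    right_distrib := fun x y z => LinearMap.congr_fun ((diagramMul n δ).map_add x y) z
    zero_mul := fun x => LinearMap.congr_fun (diagramMul n δ).map_zero x
    mul_zero := fun x => (diagramMul n δ x).map_zero
    mul_assoc := diagramMul_assoc n δ
    one_mul := diagramMul_one_left n δ
    mul_one := diagramMul_one_right n δ }

noncomputable instance (n : ℕ) (δ : k) : Algebra k (DiagramAlgebra n δ) :=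
  letI : Module k (DiagramAlgebra n δ) := inferInstanceAs (Module k (Diagram n →₀ k))
  Algebra.ofModule
    (fun c x y => LinearMap.congr_fun ((diagramMul n δ).map_smul c x) y)
    (fun c x y => (diagramMul n δ x).map_smul c y)

/-- A diagram as an element of `D_n(δ)`. -/
noncomputable def diag {n : ℕ} (δ : k) (d : Diagram n) : DiagramAlgebra n δ :=
  (Finsupp.single d 1 : Diagram n →₀ k)

end Algebra

end TemperleyLieb

open TemperleyLieb

/-!
The relations hold for the diagrams `ê_i`, so that `σ` exists; it is a bijection since it maps the
words in Jones normal form, which span `TL_n(δ)`, bijectively to the basis of diagrams.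

*Spanning* (`mul_mem_jonesSpan`). The span of the words in Jones normal form in the first `m`
generators is closed under right multiplication by these generators, by induction on `m`. A word in
Jones normal form in `m + 1` generators is such a word in `m` generators, followed by at most one
descending factor `e_m ⋯ e_r`. A letter on the right of this factor extends it, or is absorbed by
it, or commutes with it, or cuts it into two commuting factors (`descProd_mul_gen`). If then the
lower ends of the last two factors are in the wrong order, `e_l e_{l+1} e_l = e_l` allows to
exchange pieces of them (`descProd_mul_descProd`), which raises the lower end of the last factor.

*Injectivity* (`chainDiagram_injOn`). When the letters of a word in Jones normal form are stacked
one after the other, no loop is formed, and the columns of the bottom points whose partner lies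
further right are the lower ends `l` of the factors, while the columns of the top points whose
partner lies further left are the numbers `j + 1`, for `j` the upper ends (`hasEnds_chainDiagram`).
Hence the diagram determines the word.

*Surjectivity* (`exists_chainDiagram_eq`). In a diagram other than the identity, the last bottom
point whose partner lies further right is joined to its right neighbour, and a generator can be
split off there (`exists_stack_gen_eq`); so every diagram is a stack of generators
(`Diagram.induction_stack_gen`). By the spanning property in the diagram algebra over the integers
with `δ = 1`, it is the diagram of a word in Jones normal form.

*Counting* (`ncard_chain_add_choose`). The sequences of pairs `(j, l)` with `j < m` and `l < r`
satisfy the recursion of the ballot numbers, by inclusion and exclusion on the last pair.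
-/

namespace TemperleyLieb

/-! ### Stacking on top of a generator -/

section StackGen

variable {n : ℕ}

/-- The left one of the two columns that the `i`-th generator acts on. -/
def lo (i : Fin (n - 1)) : Fin n := ⟨i, by omega⟩

/-- The right one of the two columns that the `i`-th generator acts on. -/
def hi (i : Fin (n - 1)) : Fin n := ⟨i + 1, by omega⟩

theorem lo_ne_hi (i : Fin (n - 1)) : lo i ≠ hi i := by simp [lo, hi, Fin.ext_iff]

theorem gen_pair_inl (l : Fin (n - 1)) (i : Fin n) : (Diagram.gen l).pair (Sum.inl i) =
    if i = lo l then Sum.inl (hi l) else if i = hi l then Sum.inl (lo l) else Sum.inr i := rfl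

theorem gen_pair_inr (l : Fin (n - 1)) (i : Fin n) : (Diagram.gen l).pair (Sum.inr i) =
    if i = lo l then Sum.inr (hi l) else if i = hi l then Sum.inr (lo l) else Sum.inl i := rfl

theorem Diagram.pair_inj (d : Diagram n) {u v : Vertex n} : d.pair u = d.pair v ↔ u = v :=
  (Function.Involutive.injective d.pair_pair).eq_iff

theorem Diagram.pair_eq_comm (d : Diagram n) {u v : Vertex n} : d.pair u = v ↔ d.pair v = u :=
  ⟨fun h => by rw [← h, d.pair_pair], fun h => by rw [← h, d.pair_pair]⟩

theorem comp_gen_mid (d : Diagram n) (l : Fin (n - 1)) :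
    comp d (Diagram.gen l) (Sum.inr (Sum.inl (hi l))) =
      comp d (Diagram.gen l) (Sum.inr (Sum.inl (lo l))) := by
  have := comp_lower d (Diagram.gen l) (Sum.inl (lo l))
  rwa [gen_pair_inl, if_pos rfl] at this

theorem comp_gen_bot (d : Diagram n) (l : Fin (n - 1)) :
    comp d (Diagram.gen l) (Sum.inr (Sum.inr (hi l))) =
      comp d (Diagram.gen l) (Sum.inr (Sum.inr (lo l))) := by
  have := comp_lower d (Diagram.gen l) (Sum.inr (lo l))
  rwa [gen_pair_inr, if_pos rfl] at this

theorem comp_gen_straight (d : Diagram n) (l : Fin (n - 1)) {i : Fin n} (h1 : i ≠ lo l)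
    (h2 : i ≠ hi l) : comp d (Diagram.gen l) (Sum.inr (Sum.inr i)) =
      comp d (Diagram.gen l) (Sum.inr (Sum.inl i)) := by
  have := comp_lower d (Diagram.gen l) (Sum.inl i)
  rwa [gen_pair_inl, if_neg h1, if_neg h2] at this

theorem comp_gen_outer (d : Diagram n) (l : Fin (n - 1)) {v : Vertex n}
    (h1 : v ≠ Sum.inr (lo l)) (h2 : v ≠ Sum.inr (hi l)) :
    comp d (Diagram.gen l) (outer v) = comp d (Diagram.gen l) (upper v) := by
  rcases v with i | i
  · rfl
  · exact comp_gen_straight d l (fun h => h1 (by rw [h])) (fun h => h2 (by rw [h]))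

/-- Stacking a diagram on top of a generator joins the two points on its bottom line that the
generator acts on, and joins their former partners to each other. -/
theorem stack_gen_pair (d : Diagram n) (l : Fin (n - 1)) (v : Vertex n) :
    (d.stack (Diagram.gen l)).pair v =
      if v = Sum.inr (lo l) then Sum.inr (hi l)
      else if v = Sum.inr (hi l) then Sum.inr (lo l)
      else if d.pair v = Sum.inr (lo l) then d.pair (Sum.inr (hi l))
      else if d.pair v = Sum.inr (hi l) then d.pair (Sum.inr (lo l))
      else d.pair v := by
  have hne : (Sum.inr (hi l) : Vertex n) ≠ Sum.inr (lo l) := by simpa using (lo_ne_hi l).symm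
  have hmid : comp d (Diagram.gen l) (upper (Sum.inr (hi l))) =
    comp d (Diagram.gen l) (upper (Sum.inr (lo l))) := comp_gen_mid d l
  split_ifs with h1 h2 h3 h4
  · subst h1
    exact stack_pair_eq _ _ hne (comp_gen_bot d l)
  · subst h2
    exact stack_pair_eq _ _ hne.symm (comp_gen_bot d l).symm
  · have h5 : d.pair (Sum.inr (hi l)) ≠ v := fun h => hne (by rw [← h3, ← h, d.pair_pair])
    have h6 := (d.pair_eq_comm).mp h3
    refine stack_pair_eq _ _ h5 ?_
    rw [comp_gen_outer d l h1 h2, comp_gen_outer d l, comp_upper, hmid, ← h3, comp_upper]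
    · exact fun h => h2 (by rw [← h6, ← h, d.pair_pair])
    · exact d.pair_ne _
  · have h5 : d.pair (Sum.inr (lo l)) ≠ v := fun h => h3 (by rw [← h, d.pair_pair])
    have h6 := (d.pair_eq_comm).mp h4
    refine stack_pair_eq _ _ h5 ?_
    rw [comp_gen_outer d l h1 h2, comp_gen_outer d l, comp_upper, ← hmid, ← h4, comp_upper]
    · exact d.pair_ne _
    · exact fun h => h1 (by rw [← h6, ← h, d.pair_pair])
  · refine stack_pair_eq _ _ (d.pair_ne v) ?_
    rw [comp_gen_outer d l h1 h2, comp_gen_outer d l h3 h4, comp_upper]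

theorem loops_gen_of_ne (d : Diagram n) (l : Fin (n - 1))
    (h : d.pair (Sum.inr (lo l)) ≠ Sum.inr (hi l)) : loops d (Diagram.gen l) = 0 := by
  have hlo : ∃ v, comp d (Diagram.gen l) (outer v) =
      comp d (Diagram.gen l) (Sum.inr (Sum.inl (lo l))) :=
    ⟨_, (comp_gen_outer d l (d.pair_ne _) h).trans (comp_upper d _ (Sum.inr (lo l)))⟩
  have : IsEmpty (Loop d (Diagram.gen l)) := by
    refine ⟨?_⟩
    rintro ⟨⟨x | x | x⟩, hx⟩
    · exact hx (Sum.inl x) rfl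
    · by_cases h1 : x = lo l
      · obtain ⟨v, hv⟩ := hlo
        exact hx v (h1 ▸ hv)
      · by_cases h2 : x = hi l
        · obtain ⟨v, hv⟩ := hlo
          exact hx v (h2 ▸ hv.trans (comp_gen_mid d l).symm)
        · exact hx (Sum.inr x) (comp_gen_straight d l h1 h2)
    · exact hx (Sum.inr x) rfl
  exact Nat.card_of_isEmpty

theorem loops_gen_of_eq (d : Diagram n) (l : Fin (n - 1))
    (h : d.pair (Sum.inr (lo l)) = Sum.inr (hi l)) : loops d (Diagram.gen l) = 1 := by
  have h' : d.pair (Sum.inr (hi l)) = Sum.inr (lo l) := (d.pair_eq_comm).mp h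
  refine Nat.card_eq_one_iff_unique.mpr ⟨⟨?_⟩, ⟨⟨comp d (Diagram.gen l)
    (Sum.inr (Sum.inl (lo l))), fun v hv => ?_⟩⟩⟩
  · have key : ∀ c : Loop d (Diagram.gen l), c.1 = comp d (Diagram.gen l)
        (Sum.inr (Sum.inl (lo l))) := by
      rintro ⟨⟨x | x | x⟩, hx⟩
      · exact absurd rfl (hx (Sum.inl x))
      · by_cases h1 : x = lo l
        · exact congrArg (fun y => comp d (Diagram.gen l) (Sum.inr (Sum.inl y))) h1
        · by_cases h2 : x = hi l
          · exact (congrArg (fun y => comp d (Diagram.gen l) (Sum.inr (Sum.inl y))) h2).trans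
              (comp_gen_mid d l)
          · exact absurd (comp_gen_straight d l h1 h2) (hx (Sum.inr x))
      · exact absurd rfl (hx (Sum.inr x))
    exact fun a b => Subtype.ext ((key a).trans (key b).symm)
  · -- the two middle points that the generator joins form a connected component
    have := closed_of_comp_eq d (Diagram.gen l) hv.symm
      {x | x = Sum.inr (Sum.inl (lo l)) ∨ x = Sum.inr (Sum.inl (hi l))} (Or.inl rfl) ?_ ?_
    · rcases v with v | v <;> simp [outer] at this
    · rintro (v | v) hv
      · simp [upper] at hv
      · simp only [upper, Sum.map_inr, Set.mem_ofPred_eq, Sum.inr.injEq, Sum.inl.injEq] at hv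
        rcases hv with rfl | rfl
        · rw [h]; exact Or.inr rfl
        · rw [h']; exact Or.inl rfl
    · rintro (v | v) hv
      · simp only [lower, Set.mem_ofPred_eq, Sum.inr.injEq, Sum.inl.injEq] at hv
        rcases hv with rfl | rfl
        · rw [gen_pair_inl, if_pos rfl]; exact Or.inr rfl
        · rw [gen_pair_inl, if_neg (lo_ne_hi l).symm, if_pos rfl]; exact Or.inl rfl
      · simp [lower] at hv

end StackGen

section Relations

variable {n : ℕ}

theorem stack_gen_of_eq (d : Diagram n) (l : Fin (n - 1))
    (h : d.pair (Sum.inr (lo l)) = Sum.inr (hi l)) : d.stack (Diagram.gen l) = d := by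
  have h' : d.pair (Sum.inr (hi l)) = Sum.inr (lo l) := (d.pair_eq_comm).mp h
  ext1
  funext v
  rw [stack_gen_pair]
  split_ifs with h1 h2 h3 h4
  · rw [h1, h]
  · rw [h2, h']
  · exact absurd ((d.pair_eq_comm).mp h3) (fun e => h2 (by rw [← e, h]))
  · exact absurd ((d.pair_eq_comm).mp h4) (fun e => h1 (by rw [← e, h']))
  · rfl

theorem gen_stack_gen_comm (i j : Fin (n - 1)) (h : (i : ℕ) + 1 < j) :
    (Diagram.gen i).stack (Diagram.gen j) = (Diagram.gen j).stack (Diagram.gen i) := by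
  have h1 : lo i ≠ lo j := by simp [lo, Fin.ext_iff]; omega
  have h2 : lo i ≠ hi j := by simp [lo, hi, Fin.ext_iff]; omega
  have h3 : hi i ≠ lo j := by simp [lo, hi, Fin.ext_iff]; omega
  have h4 : hi i ≠ hi j := by simp [hi, Fin.ext_iff]; omega
  have h5 := lo_ne_hi i
  have h6 := lo_ne_hi j
  ext1
  funext v
  simp only [stack_gen_pair]
  rcases v with v | v <;> by_cases e1 : v = lo i <;> by_cases e2 : v = hi i <;>
    by_cases e3 : v = lo j <;> by_cases e4 : v = hi j <;>
    simp_all [gen_pair_inl, gen_pair_inr, h1.symm, h2.symm, h3.symm, h4.symm, h5.symm, h6.symm]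

theorem gen_stack_gen_stack_gen (i j : Fin (n - 1)) (h : (i : ℕ) + 1 = j ∨ (j : ℕ) + 1 = i) :
    ((Diagram.gen i).stack (Diagram.gen j)).stack (Diagram.gen i) = Diagram.gen i := by
  have h5 := lo_ne_hi i
  have h6 := lo_ne_hi j
  have h7 : (hi i = lo j ∧ lo i ≠ hi j) ∨ (lo i = hi j ∧ hi i ≠ lo j) := by
    simp only [lo, hi, ne_eq, Fin.ext_iff]; omega
  have h1 : lo i ≠ lo j := by simp only [lo, ne_eq, Fin.ext_iff]; omega
  have h4 : hi i ≠ hi j := by simp only [hi, ne_eq, Fin.ext_iff]; omega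
  ext1
  funext v
  simp only [stack_gen_pair]
  rcases h7 with ⟨h2, h3⟩ | ⟨h2, h3⟩ <;> rcases v with v | v <;> by_cases e1 : v = lo i <;>
    by_cases e2 : v = hi i <;> by_cases e3 : v = lo j <;> by_cases e4 : v = hi j <;>
    simp_all [gen_pair_inl, gen_pair_inr, h1.symm, h3.symm, h4.symm, h6.symm]

end Relations

/-! ### Chains of pairs and their number -/

section Chains

/-- Strictly decreasing lists of pairs `(j, l)` with `l ≤ j`, all whose first entries are less
than `m` and all whose second entries are less than `r`. The pairs are the ends of the descending
factors of a word in Jones normal form, the last factor first. -/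
inductive Chain : ℕ → ℕ → List (ℕ × ℕ) → Prop
  | nil (m r : ℕ) : Chain m r []
  | cons {m r j l : ℕ} {b : List (ℕ × ℕ)} (hb : Chain j l b) (hlj : l ≤ j) (hj : j < m)
      (hl : l < r) : Chain m r ((j, l) :: b)

theorem Chain.mono {m r m' r' : ℕ} {b : List (ℕ × ℕ)} (h : Chain m r b) (hm : m ≤ m')
    (hr : r ≤ r') : Chain m' r' b := by
  cases h with
  | nil => exact .nil _ _
  | cons hb hlj hj hl => exact .cons hb hlj (by omega) (by omega)

theorem Chain.lt {m r : ℕ} {b : List (ℕ × ℕ)} (h : Chain m r b) :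
    ∀ x ∈ b, x.1 < m ∧ x.2 < r := by
  induction h with
  | nil => simp
  | cons _ _ hj hl ih =>
    simp only [List.mem_cons]
    rintro x (rfl | hx)
    · exact ⟨hj, hl⟩
    · exact ⟨(ih x hx).1.trans hj, (ih x hx).2.trans hl⟩

theorem Chain.fst_lt {m r : ℕ} {b : List (ℕ × ℕ)} (h : Chain m r b) {x : ℕ}
    (hx : x ∈ b.map Prod.fst) : x < m := by
  obtain ⟨y, hy, rfl⟩ := List.mem_map.mp hx
  exact (h.lt y hy).1

theorem Chain.snd_lt {m r : ℕ} {b : List (ℕ × ℕ)} (h : Chain m r b) {x : ℕ}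
    (hx : x ∈ b.map Prod.snd) : x < r := by
  obtain ⟨y, hy, rfl⟩ := List.mem_map.mp hx
  exact (h.lt y hy).2

/-- A strictly decreasing list of pairs is determined by the two sets of entries. -/
theorem Chain.eq_of_mem_iff {m r m' r' : ℕ} {b b' : List (ℕ × ℕ)} (h : Chain m r b)
    (h' : Chain m' r' b') (h1 : ∀ x, x ∈ b.map Prod.fst ↔ x ∈ b'.map Prod.fst)
    (h2 : ∀ x, x ∈ b.map Prod.snd ↔ x ∈ b'.map Prod.snd) : b = b' := by
  induction h generalizing m' r' b' with
  | nil =>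
    rcases b' with _ | ⟨⟨j, l⟩, b'⟩
    · rfl
    · simpa using h1 j
  | @cons m r j l b hb hlj hj hl ih =>
    rcases h' with _ | @⟨_, _, j', l', b', hb', hlj', hj', hl'⟩
    · simpa using h1 j
    simp only [List.map_cons, List.mem_cons] at h1 h2
    have f1 := fun x => hb.fst_lt (x := x)
    have f1' := fun x => hb'.fst_lt (x := x)
    have f2 := fun x => hb.snd_lt (x := x)
    have f2' := fun x => hb'.snd_lt (x := x)
    obtain rfl : j = j' := by
      have a1 := (h1 j).mp (Or.inl rfl)
      have a2 := (h1 j').mpr (Or.inl rfl)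
      have a3 := f1 j'
      have a4 := f1' j
      grind
    obtain rfl : l = l' := by
      have a1 := (h2 l).mp (Or.inl rfl)
      have a2 := (h2 l').mpr (Or.inl rfl)
      have a3 := f2 l'
      have a4 := f2' l
      grind
    rw [ih hb' (fun x => ?_) (fun x => ?_)]
    · have a1 := h1 x
      have a2 := f1 x
      have a3 := f1' x
      grind
    · have a1 := h2 x
      have a2 := f2 x
      have a3 := f2' x
      grind

theorem setOf_chain_zero_right (m : ℕ) : {b | Chain m 0 b} = {[]} := by
  ext b
  constructor
  · rintro (_ | ⟨_, _, _, hl⟩)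
    · rfl
    · omega
  · rintro rfl
    exact .nil _ _

/-- As `l ≤ j < m` holds in a chain, a bound on the second entries beyond `m` has no effect. -/
theorem setOf_chain_succ_right (m : ℕ) : {b | Chain m (m + 1) b} = {b | Chain m m b} := by
  ext b
  constructor
  · rintro (_ | ⟨hb, hlj, hj, -⟩)
    · exact .nil _ _
    · exact .cons hb hlj hj (by omega)
  · exact fun h => h.mono le_rfl (by omega)

theorem setOf_chain_succ_succ {m r : ℕ} (h : r ≤ m) : {b | Chain (m + 1) (r + 1) b} =
    ({b | Chain m (r + 1) b} ∪ {b | Chain (m + 1) r b}) ∪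
      List.cons (m, r) '' {b | Chain m r b} := by
  ext b
  constructor
  · rintro (_ | @⟨_, _, j, l, b, hb, hlj, hj, hl⟩)
    · exact Or.inl (Or.inl (.nil _ _))
    · rcases Nat.lt_or_ge j m with hj' | hj'
      · exact Or.inl (Or.inl (.cons hb hlj hj' hl))
      · rcases Nat.lt_or_ge l r with hl' | hl'
        · exact Or.inl (Or.inr (.cons hb hlj hj hl'))
        · obtain rfl : j = m := by omega
          obtain rfl : l = r := by omega
          exact Or.inr ⟨b, hb, rfl⟩
  · rintro ((hb | hb) | ⟨b, hb, rfl⟩)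
    · exact Chain.mono hb (by omega) le_rfl
    · exact Chain.mono hb le_rfl (by omega)
    · exact .cons hb h (by omega) (by omega)

theorem setOf_chain_inter (m r : ℕ) :
    {b | Chain m (r + 1) b} ∩ {b | Chain (m + 1) r b} = {b | Chain m r b} := by
  ext b
  constructor
  · rintro ⟨_ | ⟨hb, hlj, hj, _⟩, h2⟩
    · exact .nil _ _
    · rcases h2 with _ | ⟨_, _, _, hl⟩
      exact .cons hb hlj hj hl
  · exact fun h => ⟨Chain.mono h le_rfl (by omega), Chain.mono h (by omega) le_rfl⟩

theorem finite_setOf_chain (m r : ℕ) : {b | Chain m r b}.Finite := by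
  induction m generalizing r with
  | zero =>
    refine (Set.finite_singleton []).subset ?_
    rintro b (_ | ⟨_, _, hj, _⟩)
    · rfl
    · omega
  | succ m ih =>
    refine ((Set.finite_singleton []).union ((Set.finite_Iic m).biUnion fun j _ =>
      (Set.finite_Iic m).biUnion fun l _ => (ih m).image (List.cons (j, l)))).subset ?_
    rintro b (_ | @⟨_, _, j, l, b, hb, hlj, hj, hl⟩)
    · exact Or.inl rfl
    · refine Or.inr (Set.mem_biUnion (x := j) (by simp only [Set.mem_Iic]; omega)
        (Set.mem_biUnion (x := l) (by simp only [Set.mem_Iic]; omega) ⟨b, ?_, rfl⟩))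
      exact hb.mono (by omega) (by omega)

theorem ncard_chain_succ_succ {m r : ℕ} (h : r ≤ m) : {b | Chain (m + 1) (r + 1) b}.ncard =
    {b | Chain m (r + 1) b}.ncard + {b | Chain (m + 1) r b}.ncard := by
  have f := finite_setOf_chain
  rw [setOf_chain_succ_succ h, Set.ncard_union_eq _ ((f _ _).union (f _ _)) ((f _ _).image _),
    Set.ncard_image_of_injective _ (List.cons_injective),
    ← Set.ncard_union_add_ncard_inter _ _ (f _ _) (f _ _), setOf_chain_inter]
  rw [Set.disjoint_left]
  rintro _ (h1 | h1) ⟨b, -, rfl⟩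
  · rcases h1 with _ | ⟨_, _, hj, _⟩
    omega
  · rcases h1 with _ | ⟨_, _, _, hl⟩
    omega

/-- The chains are counted by the ballot numbers. -/
theorem ncard_chain_add_choose : ∀ s m r : ℕ, m + r = s → r ≤ m + 1 →
    {b | Chain m r b}.ncard + (m + r + 1).choose (m + 2) = (m + r + 1).choose r := by
  intro s
  induction s using Nat.strong_induction_on with
  | _ s ih =>
    intro m r hs hr
    rcases r with _ | r
    · simp [setOf_chain_zero_right]
    rcases Nat.lt_or_ge m (r + 1) with h | h
    · obtain rfl : m = r := by omega
      have h1 := ih (m + m) (by omega) m m rfl (by omega)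
      rw [setOf_chain_succ_right, show m + (m + 1) + 1 = (m + m + 1) + 1 by ring,
        Nat.choose_succ_succ' (m + m + 1) (m + 1), Nat.choose_succ_succ' (m + m + 1) m,
        show m + 1 + 1 = m + 2 by ring]
      omega
    · rcases m with _ | m
      · omega
      have h1 := ih (m + (r + 1)) (by omega) m (r + 1) rfl (by omega)
      have h2 := ih (m + 1 + r) (by omega) (m + 1) r rfl (by omega)
      rw [ncard_chain_succ_succ (by omega), show m + 1 + (r + 1) + 1 = (m + r + 2) + 1 by ring,
        Nat.choose_succ_succ' (m + r + 2) (m + 2), Nat.choose_succ_succ' (m + r + 2) r]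
      rw [show m + (r + 1) + 1 = m + r + 2 by ring] at h1
      rw [show m + 1 + r + 1 = m + r + 2 by ring, show m + 1 + 2 = m + 2 + 1 by ring] at h2
      omega

theorem ncard_chain_eq_catalan (m : ℕ) : (m + 2) * {b | Chain m m b}.ncard =
    (2 * (m + 1)).choose (m + 1) := by
  have h := ncard_chain_add_choose (m + m) m m rfl (by omega)
  have h1 : (m + m + 1).choose (m + 1) = (m + m + 1).choose m :=
    Nat.choose_symm_of_eq_add (by omega)
  have h2 := Nat.choose_succ_right_eq (m + m + 1) (m + 1)
  rw [show 2 * (m + 1) = (m + m + 1) + 1 by ring, Nat.choose_succ_succ, h1]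
  rw [show m + m + 1 - (m + 1) = m by omega, h1] at h2
  simp only [Nat.add_assoc, Nat.reduceAdd] at h h2 ⊢
  nlinarith

end Chains

/-! ### Words in Jones normal form span -/

section Span

/-- The descending product `e (l + t - 1) * ⋯ * e (l + 1) * e l` with `t` factors. -/
def descProd {A : Type*} [Monoid A] (e : ℕ → A) (l : ℕ) : ℕ → A
  | 0 => 1
  | t + 1 => e (l + t) * descProd e l t

/-- The product over a chain of the descending products from `j` to `l`. -/
def chainProd {A : Type*} [Monoid A] (e : ℕ → A) : List (ℕ × ℕ) → A
  | [] => 1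
  | (j, l) :: b => chainProd e b * descProd e l (j + 1 - l)

section Monoid

variable {A : Type*} [Monoid A] (e : ℕ → A)

theorem descProd_add (l s t : ℕ) :
    descProd e l (s + t) = descProd e (l + s) t * descProd e l s := by
  induction t with
  | zero => rw [descProd, one_mul, Nat.add_zero]
  | succ t ih => rw [← Nat.add_assoc, descProd, ih, descProd, mul_assoc, Nat.add_assoc]

theorem descProd_one (l : ℕ) : descProd e l 1 = e l := by
  rw [descProd, descProd, mul_one, Nat.add_zero]

theorem descProd_succ_right (l t : ℕ) : descProd e l (t + 1) = descProd e (l + 1) t * e l := by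
  rw [Nat.add_comm, descProd_add, descProd_one]

variable {e}

theorem commute_descProd (hc : ∀ i j, i + 1 < j → Commute (e i) (e j)) {i l t : ℕ}
    (h : i + 1 < l ∨ l + t < i + 1 ∧ l + t ≠ i) : Commute (e i) (descProd e l t) := by
  induction t with
  | zero => exact Commute.one_right _
  | succ t ih =>
    refine Commute.mul_right ?_ (ih (by omega))
    rcases h with h | h
    · exact hc _ _ (by omega)
    · exact (hc _ _ (by omega)).symm

theorem descProd_commute_descProd (hc : ∀ i j, i + 1 < j → Commute (e i) (e j)) {l s l' t : ℕ}
    (h : l + s < l') : Commute (descProd e l s) (descProd e l' t) := by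
  induction s with
  | zero => exact Commute.one_left _
  | succ s ih => exact Commute.mul_left (commute_descProd hc (by omega)) (ih (by omega))

end Monoid

variable {k A : Type*} [CommRing k] [Ring A] [Algebra k A]

/-- The elements `e 0, …, e (N - 1)` satisfy the defining relations of the Temperley-Lieb algebra.
The relations that hold also for `e i = 0` are not restricted to indices below `N`. -/
structure IsTLFamily (δ : k) (N : ℕ) (e : ℕ → A) : Prop where
  sq : ∀ i, e i * e i = δ • e i
  up : ∀ i, i + 1 < N → e i * e (i + 1) * e i = e i
  down : ∀ i, i + 1 < N → e (i + 1) * e i * e (i + 1) = e (i + 1)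
  comm : ∀ i j, i + 1 < j → Commute (e i) (e j)

/-- The submodule spanned by the words in Jones normal form in the first `m` elements of `e`. -/
def jonesSpan (k : Type*) [CommRing k] {A : Type*} [Ring A] [Algebra k A] (e : ℕ → A) (m : ℕ) :
    Submodule k A :=
  Submodule.span k (chainProd e '' {b | Chain m m b})

variable {δ : k} {N : ℕ} {e : ℕ → A}

theorem chainProd_mem_jonesSpan {m : ℕ} {b : List (ℕ × ℕ)} (h : Chain m m b) :
    chainProd e b ∈ jonesSpan k e m :=
  Submodule.subset_span ⟨b, h, rfl⟩

theorem jonesSpan_mono (m : ℕ) : jonesSpan k e m ≤ jonesSpan k e (m + 1) :=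
  Submodule.span_mono (Set.image_mono fun _ h => Chain.mono h (by omega) (by omega))

theorem mul_mem_of_forall_chain {m : ℕ} {V : Submodule k A} {y : A}
    (h : ∀ b, Chain m m b → chainProd e b * y ∈ V) {x : A} (hx : x ∈ jonesSpan k e m) :
    x * y ∈ V := by
  have : jonesSpan k e m ≤ V.comap (LinearMap.mulRight k y) := by
    refine Submodule.span_le.mpr ?_
    rintro _ ⟨b, hb, rfl⟩
    exact h b hb
  exact this hx

theorem mul_descProd_mem {V : Submodule k A} {m : ℕ} (hV : ∀ x ∈ V, ∀ i < m, x * e i ∈ V)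
    {l t : ℕ} (h : l + t ≤ m) {x : A} (hx : x ∈ V) : x * descProd e l t ∈ V := by
  induction t generalizing x with
  | zero => rwa [descProd, mul_one]
  | succ t ih =>
    rw [descProd, ← mul_assoc]
    exact ih (by omega) (hV x hx _ (by omega))

/-- The key reduction: two descending factors whose lower ends `l ≥ r` are in the wrong order are
replaced by two descending factors whose lower ends are in the right order, by means of
`e_l e_{l+1} e_l = e_l`. -/
theorem descProd_mul_descProd (he : IsTLFamily δ N e) {j l m r : ℕ} (hlj : l ≤ j) (hj : j < m)
    (hm : m < N) (hr : r ≤ l) : descProd e l (j + 1 - l) * descProd e r (m + 1 - r) =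
      descProd e (l + 1) (j - l) * descProd e r (l + 1 - r) * descProd e (l + 2) (m - 1 - l) := by
  have h1 : descProd e l (j + 1 - l) = descProd e (l + 1) (j - l) * e l := by
    rw [← descProd_succ_right]; congr 1; omega
  have h2 : descProd e r (l + 1 - r) = e l * descProd e r (l - r) := by
    rw [show l + 1 - r = l - r + 1 by omega, descProd, show r + (l - r) = l by omega]
  have h3 : descProd e r (m + 1 - r) =
      descProd e (l + 2) (m - 1 - l) * (e (l + 1) * descProd e r (l + 1 - r)) := by
    rw [show m + 1 - r = (l + 1 - r + 1) + (m - 1 - l) by omega, descProd_add, descProd,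
      show r + (l + 1 - r) = l + 1 by omega, show r + (l + 1 - r + 1) = l + 2 by omega]
  have c1 : Commute (e l) (descProd e (l + 2) (m - 1 - l)) :=
    commute_descProd he.comm (by omega)
  have c2 : Commute (descProd e r (l + 1 - r)) (descProd e (l + 2) (m - 1 - l)) :=
    descProd_commute_descProd he.comm (by omega)
  rw [mul_assoc, c2.eq, h1, h3, h2]
  calc descProd e (l + 1) (j - l) * e l *
        (descProd e (l + 2) (m - 1 - l) * (e (l + 1) * (e l * descProd e r (l - r))))
      = descProd e (l + 1) (j - l) * ((e l * descProd e (l + 2) (m - 1 - l)) *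
          (e (l + 1) * (e l * descProd e r (l - r)))) := by simp only [mul_assoc]
    _ = descProd e (l + 1) (j - l) * (descProd e (l + 2) (m - 1 - l) *
          ((e l * e (l + 1) * e l) * descProd e r (l - r))) := by
        rw [c1.eq]; simp only [mul_assoc]
    _ = _ := by rw [he.up l (by omega)]

/-- A letter in the interior of a descending factor cuts it into two commuting factors. -/
theorem descProd_mul_gen (he : IsTLFamily δ N e) {m r i : ℕ} (hm : m < N) (hr : r < i)
    (hi : i ≤ m) : descProd e r (m + 1 - r) * e i =
      descProd e r (i - 1 - r) * descProd e i (m + 1 - i) := by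
  obtain ⟨i, rfl⟩ : ∃ i', i = i' + 1 := ⟨i - 1, by omega⟩
  have h1 : descProd e (i + 1) (m + 1 - (i + 1)) =
      descProd e (i + 2) (m - (i + 1)) * e (i + 1) := by
    rw [← descProd_succ_right]; congr 1; omega
  have h2 : descProd e r (m + 1 - r) = descProd e (i + 2) (m - (i + 1)) *
      (e (i + 1) * (e i * descProd e r (i - r))) := by
    rw [show m + 1 - r = (i - r + 1 + 1) + (m - (i + 1)) by omega, descProd_add, descProd,
      descProd, show r + (i - r + 1) = i + 1 by omega, show r + (i - r) = i by omega,
      show r + (i - r + 1 + 1) = i + 2 by omega]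
  have c1 : Commute (e (i + 1)) (descProd e r (i - r)) := commute_descProd he.comm (by omega)
  have c2 : Commute (descProd e r (i - r)) (descProd e (i + 1) (m + 1 - (i + 1))) :=
    descProd_commute_descProd he.comm (by omega)
  rw [show i + 1 - 1 - r = i - r by omega, c2.eq, h1, h2]
  calc descProd e (i + 2) (m - (i + 1)) * (e (i + 1) * (e i * descProd e r (i - r))) * e (i + 1)
      = descProd e (i + 2) (m - (i + 1)) * (e (i + 1) * (e i *
          (descProd e r (i - r) * e (i + 1)))) := by simp only [mul_assoc]
    _ = descProd e (i + 2) (m - (i + 1)) * ((e (i + 1) * e i * e (i + 1)) *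
          descProd e r (i - r)) := by rw [← c1.eq]; simp only [mul_assoc]
    _ = _ := by rw [he.down i (by omega), mul_assoc]

/-- Appending a descending factor that starts with the new letter `e m` stays in the span: if the
lower ends are in the wrong order, the key reduction raises the lower end of the last factor. -/
theorem mul_descProd_mem_jonesSpan_succ (he : IsTLFamily δ N e) {m : ℕ} (hm : m < N)
    (hV : ∀ x ∈ jonesSpan k e m, ∀ i < m, x * e i ∈ jonesSpan k e m) (r : ℕ) (hr : r ≤ m + 1)
    {x : A} (hx : x ∈ jonesSpan k e m) :
    x * descProd e r (m + 1 - r) ∈ jonesSpan k e (m + 1) := by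
  induction hs : m + 1 - r using Nat.strong_induction_on generalizing r x with
  | _ s ih =>
    subst hs
    rcases Nat.lt_or_ge m r with hrm | hrm
    · rw [show m + 1 - r = 0 by omega, descProd, mul_one]
      exact jonesSpan_mono m hx
    refine mul_mem_of_forall_chain ?_ hx
    rintro b (_ | @⟨_, _, j, l, b, hb, hlj, hj, hl⟩)
    · exact chainProd_mem_jonesSpan (b := [(m, r)])
        (.cons (.nil _ _) hrm (by omega) (by omega))
    · rcases Nat.lt_or_ge l r with hlr | hlr
      · exact chainProd_mem_jonesSpan (b := (m, r) :: (j, l) :: b)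
          (.cons (.cons hb hlj hj hlr) hrm (by omega) (by omega))
      · rw [chainProd, mul_assoc, descProd_mul_descProd he hlj hj hm hlr, ← mul_assoc, ← mul_assoc]
        have h := ih (m + 1 - (l + 2)) (by omega) (l + 2) (by omega)
          (x := chainProd e b * descProd e (l + 1) (j - l) * descProd e r (l + 1 - r)) ?_ rfl
        · rwa [show m + 1 - (l + 2) = m - 1 - l by omega] at h
        · refine mul_descProd_mem hV (by omega) (mul_descProd_mem hV (by omega) ?_)
          exact chainProd_mem_jonesSpan (hb.mono (by omega) (by omega))

/-- The span of the words in Jones normal form is closed under multiplication by the generators. -/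
theorem mul_mem_jonesSpan (he : IsTLFamily δ N e) {m : ℕ} (hm : m ≤ N) :
    ∀ x ∈ jonesSpan k e m, ∀ i < m, x * e i ∈ jonesSpan k e m := by
  induction m with
  | zero => intro x _ i hi; omega
  | succ m ih =>
    have hV := ih (by omega)
    have key := mul_descProd_mem_jonesSpan_succ he (by omega) hV
    intro x hx i hi
    have low : ∀ y ∈ jonesSpan k e m, y * e i ∈ jonesSpan k e (m + 1) := by
      intro y hy
      rcases Nat.lt_or_ge i m with him | him
      · exact jonesSpan_mono m (hV y hy i him)
      · obtain rfl : i = m := by omega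
        have := key i (by omega) hy
        rwa [show i + 1 - i = 1 by omega, descProd_one] at this
    refine mul_mem_of_forall_chain ?_ hx
    rintro b (_ | @⟨_, _, j, r, b, hb, hrj, hj, hr⟩)
    · exact low _ (chainProd_mem_jonesSpan (.nil _ _))
    rcases Nat.lt_or_ge j m with hjm | hjm
    · exact low _ (chainProd_mem_jonesSpan (.cons hb hrj hjm (by omega)))
    obtain rfl : j = m := by omega
    have hz : chainProd e b ∈ jonesSpan k e j :=
      chainProd_mem_jonesSpan (hb.mono le_rfl hrj)
    rw [chainProd, mul_assoc]
    rcases lt_trichotomy i r with hir | rfl | hir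
    · rcases Nat.lt_or_ge (i + 1) r with hir' | hir'
      · rw [← (commute_descProd he.comm (Or.inl hir')).eq, ← mul_assoc]
        exact key r (by omega) (hV _ hz i (by omega))
      · obtain rfl : r = i + 1 := by omega
        rw [← descProd_succ_right, show j + 1 - (i + 1) + 1 = j + 1 - i by omega]
        exact key i (by omega) hz
    · rw [show j + 1 - i = j - i + 1 by omega, descProd_succ_right, mul_assoc, he.sq,
        mul_smul_comm, mul_smul_comm, ← descProd_succ_right,
        show j - i + 1 = j + 1 - i by omega]
      exact Submodule.smul_mem _ _ (key i (by omega) hz)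
    · rw [descProd_mul_gen he (by omega) hir (by omega), ← mul_assoc]
      exact key i (by omega) (mul_descProd_mem hV (by omega) hz)

end Span

/-! ### The diagram of a word in Jones normal form -/

section Ends

variable {n : ℕ}

/-- The column of a marked point, on either line. -/
def col : Vertex n → ℕ := Sum.elim (fun i => i) (fun i => i)

@[simp] theorem col_inl (i : Fin n) : col (Sum.inl i : Vertex n) = i := rfl

@[simp] theorem col_inr (i : Fin n) : col (Sum.inr i : Vertex n) = i := rfl

theorem lo_val (l : Fin (n - 1)) : (lo l : ℕ) = l := rfl

theorem hi_val (l : Fin (n - 1)) : (hi l : ℕ) = l + 1 := rfl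

theorem stack_gen_pair_lo (d : Diagram n) (l : Fin (n - 1)) :
    (d.stack (Diagram.gen l)).pair (Sum.inr (lo l)) = Sum.inr (hi l) := by
  rw [stack_gen_pair, if_pos rfl]

theorem stack_gen_pair_hi (d : Diagram n) (l : Fin (n - 1)) :
    (d.stack (Diagram.gen l)).pair (Sum.inr (hi l)) = Sum.inr (lo l) :=
  (Diagram.pair_eq_comm _).mp (stack_gen_pair_lo d l)

/-! Stacking `d` on top of the generator `l` joins the partner of the bottom point `l` and the
partner of the bottom point `l + 1`. If the former does not lie to the right of column `l`, nor the
latter to the left of column `l + 1`, then all other points keep the side on which their partners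
lie. -/

section Step

variable (d : Diagram n) (l : Fin (n - 1)) (hp : col (d.pair (Sum.inr (lo l))) ≤ l)
include hp

theorem pair_lo_ne_hi : d.pair (Sum.inr (lo l)) ≠ Sum.inr (hi l) := by
  intro h
  rw [h, col_inr, hi_val] at hp
  omega

theorem stack_gen_pair_pair_hi :
    (d.stack (Diagram.gen l)).pair (d.pair (Sum.inr (hi l))) = d.pair (Sum.inr (lo l)) := by
  have h1 : d.pair (Sum.inr (hi l)) ≠ Sum.inr (lo l) := fun h =>
    pair_lo_ne_hi d l hp ((d.pair_eq_comm).mp h)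
  rw [stack_gen_pair, if_neg h1, if_neg (d.pair_ne _), d.pair_pair,
    if_neg (by simpa using (lo_ne_hi l).symm), if_pos rfl]

variable (hq : l + 1 ≤ col (d.pair (Sum.inr (hi l))))
include hq

theorem col_stack_gen_pair_inl (i : Fin n) (hi' : Sum.inl i ≠ d.pair (Sum.inr (hi l))) :
    col ((d.stack (Diagram.gen l)).pair (Sum.inl i)) < i ↔ col (d.pair (Sum.inl i)) < i := by
  rw [stack_gen_pair, if_neg (by simp), if_neg (by simp)]
  split_ifs with h1 h2
  · rw [← h1, d.pair_pair, col_inl] at hp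
    rw [h1, col_inr, lo_val]
    omega
  · exact absurd ((d.pair_eq_comm).mp h2).symm hi'
  · rfl

theorem col_stack_gen_pair_inr (i : Fin n) (h1 : i ≠ lo l) (h2 : i ≠ hi l)
    (h3 : Sum.inr i ≠ d.pair (Sum.inr (hi l))) :
    i < col ((d.stack (Diagram.gen l)).pair (Sum.inr i)) ↔ i < col (d.pair (Sum.inr i)) := by
  rw [stack_gen_pair, if_neg (by simpa using h1), if_neg (by simpa using h2)]
  split_ifs with h4 h5
  · rw [← h4, d.pair_pair, col_inr] at hp
    rw [h4, col_inr, lo_val]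
    have := Fin.val_ne_of_ne h1
    rw [lo_val] at this
    omega
  · exact absurd ((d.pair_eq_comm).mp h5).symm h3
  · rfl

end Step

/-- The strands of the diagram beyond column `m` are vertical, the top points whose partner lies
in a column further left are those in the columns `j + 1` with `j ∈ J`, and the bottom points whose
partner lies in a column further right are those in the columns in `K`. -/
structure HasEnds (d : Diagram n) (m : ℕ) (J K : Set ℕ) : Prop where
  straight : ∀ i : Fin n, m < i → d.pair (Sum.inr i) = Sum.inl i
  top : ∀ i : Fin n, col (d.pair (Sum.inl i)) < i ↔ ∃ j ∈ J, (i : ℕ) = j + 1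
  bot : ∀ i : Fin n, i < col (d.pair (Sum.inr i)) ↔ (i : ℕ) ∈ K

theorem hasEnds_one : HasEnds (Diagram.one n) 0 ∅ ∅ where
  straight _ _ := rfl
  top i := by simp [Diagram.one]
  bot i := by simp [Diagram.one]

theorem HasEnds.mono {d : Diagram n} {m m' : ℕ} {J K : Set ℕ} (h : HasEnds d m J K)
    (hm : m ≤ m') : HasEnds d m' J K :=
  ⟨fun i hi => h.straight i (by omega), h.top, h.bot⟩

theorem HasEnds.pair_straight {d : Diagram n} {m : ℕ} {J K : Set ℕ} (h : HasEnds d m J K)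
    (l : Fin (n - 1)) (hl : (l : ℕ) + 1 ≤ m) (i : Fin n) (hi : m < i) :
    (d.stack (Diagram.gen l)).pair (Sum.inr i) = Sum.inl i := by
  rw [stack_gen_pair, h.straight i hi, if_neg, if_neg, if_neg (by simp), if_neg (by simp)] <;>
  · simp only [Sum.inr.injEq, Fin.ext_iff, lo_val, hi_val]
    omega

/-- The first letter of a descending factor, larger than all earlier letters. -/
theorem HasEnds.stack_gen_first {d : Diagram n} {J K : Set ℕ} {l : Fin (n - 1)}
    (h : HasEnds d l J K) (hK : (l : ℕ) ∉ K) :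
    loops d (Diagram.gen l) = 0 ∧
      HasEnds (d.stack (Diagram.gen l)) (l + 1) (insert (l : ℕ) J) (insert (l : ℕ) K) := by
  have hp : col (d.pair (Sum.inr (lo l))) ≤ l := by
    have := (h.bot (lo l)).not.mpr (by rwa [lo_val])
    rw [lo_val] at this
    omega
  have hs : d.pair (Sum.inr (hi l)) = Sum.inl (hi l) := h.straight _ (by rw [hi_val]; omega)
  have hq : l + 1 ≤ col (d.pair (Sum.inr (hi l))) := by rw [hs, col_inl, hi_val]
  refine ⟨loops_gen_of_ne d l (pair_lo_ne_hi d l hp),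
    fun i hi => (h.mono (Nat.le_succ _)).pair_straight l le_rfl i hi, fun i => ?_, fun i => ?_⟩
  · by_cases hi' : i = hi l
    · have := stack_gen_pair_pair_hi d l hp
      rw [hs] at this
      rw [hi', this, hi_val]
      exact ⟨fun _ => ⟨l, Set.mem_insert _ _, rfl⟩, fun _ => by omega⟩
    · rw [col_stack_gen_pair_inl d l hp hq i (by rw [hs]; simpa using hi'), h.top]
      rw [Fin.ext_iff, hi_val] at hi'
      simp [hi']
  · by_cases h1 : i = lo l
    · rw [h1, stack_gen_pair_lo, col_inr, lo_val, hi_val]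
      simp
    by_cases h2 : i = hi l
    · have h3 := (h.bot (hi l)).not.mp (by rw [hs, col_inl]; omega)
      rw [hi_val] at h3
      rw [h2, stack_gen_pair_hi, col_inr, lo_val, hi_val]
      simp [h3]
    · rw [col_stack_gen_pair_inr d l hp hq i h1 h2 (by rw [hs]; simp), h.bot]
      rw [Fin.ext_iff, lo_val] at h1
      simp [h1]

/-- A further letter of a descending factor, which follows the letter `l + 1`. -/
theorem HasEnds.stack_gen_next {d : Diagram n} {m : ℕ} {J K : Set ℕ} {l : Fin (n - 1)} {c : Fin n}
    (hc : (c : ℕ) = l + 2) (h : HasEnds d m J (insert ((l : ℕ) + 1) K))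
    (ha : d.pair (Sum.inr (hi l)) = Sum.inr c) (hK : ∀ x ∈ K, x < l) (hm : (l : ℕ) + 1 ≤ m) :
    loops d (Diagram.gen l) = 0 ∧
      HasEnds (d.stack (Diagram.gen l)) m J (insert (l : ℕ) K) := by
  have hp : col (d.pair (Sum.inr (lo l))) ≤ l := by
    have := (h.bot (lo l)).not.mpr (by
      rw [lo_val]
      rintro (h1 | h1)
      · omega
      · exact absurd (hK _ h1) (by omega))
    rw [lo_val] at this
    omega
  have hq : l + 1 ≤ col (d.pair (Sum.inr (hi l))) := by rw [ha, col_inr]; omega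
  refine ⟨loops_gen_of_ne d l (pair_lo_ne_hi d l hp), h.pair_straight l hm, fun i => ?_,
    fun i => ?_⟩
  · rw [col_stack_gen_pair_inl d l hp hq i (by rw [ha]; simp), h.top]
  · by_cases h1 : i = lo l
    · rw [h1, stack_gen_pair_lo, col_inr, lo_val, hi_val]
      simp
    have h1' := Fin.val_ne_of_ne h1
    rw [lo_val] at h1'
    by_cases h2 : i = hi l
    · rw [h2, stack_gen_pair_hi, col_inr, lo_val, hi_val]
      refine iff_of_false (by omega) ?_
      rintro (h3 | h3)
      · omega
      · exact absurd (hK _ h3) (by omega)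
    have h2' := Fin.val_ne_of_ne h2
    rw [hi_val] at h2'
    by_cases h3 : i = c
    · have := stack_gen_pair_pair_hi d l hp
      rw [ha] at this
      rw [h3, this]
      refine iff_of_false (by omega) ?_
      rintro (h4 | h4)
      · omega
      · exact absurd (hK _ h4) (by omega)
    · rw [col_stack_gen_pair_inr d l hp hq i h1 h2 (by rw [ha]; simpa using h3), h.bot]
      simp [h1', h2']

end Ends

section ChainDiagram

/-- The `i`-th generating diagram, for any natural number `i`; the identity diagram if there is no
`i`-th generator. -/
def genDiagram (n i : ℕ) : Diagram n :=
  if h : i < n - 1 then Diagram.gen ⟨i, h⟩ else Diagram.one n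

variable {n : ℕ}

theorem genDiagram_val (l : Fin (n - 1)) : genDiagram n l = Diagram.gen l := dif_pos l.2

/-- The stack of a diagram on top of the descending word `e_{l+t-1} ⋯ e_l`. -/
noncomputable def Diagram.stackDesc (d : Diagram n) (l : ℕ) : ℕ → Diagram n
  | 0 => d
  | t + 1 => (d.stackDesc (l + 1) t).stack (genDiagram n l)

/-- The diagram of the word in Jones normal form that is given by a chain. -/
noncomputable def chainDiagram (n : ℕ) : List (ℕ × ℕ) → Diagram n
  | [] => Diagram.one n
  | (j, l) :: b => (chainDiagram n b).stackDesc l (j + 1 - l)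

theorem HasEnds.stackDesc {d : Diagram n} {J K : Set ℕ} {j : ℕ} (hj : j < n - 1)
    (h : HasEnds d j J K) (t l : ℕ) (hl : l + t = j) (hK : ∀ x ∈ K, x < l) :
    loops (d.stackDesc (l + 1) t) (genDiagram n l) = 0 ∧
      HasEnds (d.stackDesc l (t + 1)) (j + 1) (insert j J) (insert l K) := by
  induction t generalizing l with
  | zero =>
    obtain rfl : l = j := by omega
    rw [Diagram.stackDesc, Diagram.stackDesc, genDiagram_val ⟨l, hj⟩]
    exact HasEnds.stack_gen_first (l := ⟨l, hj⟩) h (fun h' => absurd (hK _ h') (by simp))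
  | succ t ih =>
    have hl' : l < n - 1 := by omega
    have hl'' : l + 1 < n - 1 := by omega
    have h1 := (ih (l + 1) (by omega) (fun x hx => (hK x hx).trans (by omega))).2
    rw [Diagram.stackDesc.eq_2 d l, genDiagram_val ⟨l, hl'⟩]
    refine HasEnds.stack_gen_next (l := ⟨l, hl'⟩) (c := hi ⟨l + 1, hl''⟩) rfl h1 ?_ hK
      (by simp only; omega)
    rw [Diagram.stackDesc, genDiagram_val ⟨l + 1, hl''⟩]
    exact stack_gen_pair_lo _ _

/-- A chain can be read off from the partners of the marked points of its diagram. -/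
theorem hasEnds_chainDiagram {m r : ℕ} {b : List (ℕ × ℕ)} (h : Chain m r b) (hm : m ≤ n - 1) :
    HasEnds (chainDiagram n b) m {x | x ∈ b.map Prod.fst} {x | x ∈ b.map Prod.snd} := by
  induction h with
  | nil m r => simpa [chainDiagram] using hasEnds_one.mono (Nat.zero_le m)
  | @cons m r j l b hb hlj hj hl ih =>
    have h := (HasEnds.stackDesc (by omega) (ih (by omega)) (j - l) l (by omega)
      (fun x hx => hb.snd_lt hx)).2
    rw [show j - l + 1 = j + 1 - l by omega] at h
    simp only [List.map_cons, List.mem_cons]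
    exact h.mono hj

theorem chainDiagram_injOn : Set.InjOn (chainDiagram n) {b | Chain (n - 1) (n - 1) b} := by
  intro b hb b' hb' hbb
  have h := hasEnds_chainDiagram hb le_rfl
  have h' := hasEnds_chainDiagram hb' le_rfl
  rw [← hbb] at h'
  refine Chain.eq_of_mem_iff hb hb' (fun x => ?_) (fun x => ?_)
  · by_cases hx : x + 1 < n
    · simpa using (h.top ⟨x + 1, hx⟩).symm.trans (h'.top ⟨x + 1, hx⟩)
    · refine iff_of_false (fun hx' => ?_) (fun hx' => ?_)
      · have := hb.fst_lt hx'
        omega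
      · have := hb'.fst_lt hx'
        omega
  · by_cases hx : x < n
    · exact (h.bot ⟨x, hx⟩).symm.trans (h'.bot ⟨x, hx⟩)
    · refine iff_of_false (fun hx' => ?_) (fun hx' => ?_)
      · have := hb.snd_lt hx'
        omega
      · have := hb'.snd_lt hx'
        omega

end ChainDiagram

section Family

variable {k : Type*} [CommRing k] {n : ℕ} (δ : k)

theorem diag_mul_diag (d d' : Diagram n) :
    diag δ d * diag δ d' = δ ^ loops d d' • diag δ (d.stack d') := by
  refine (diagramMul_single n δ d d' 1 1).trans ?_
  rw [one_mul, one_mul]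
  exact (Finsupp.smul_single_one _ _).symm

theorem diag_mul_gen_of_loops {d d' : Diagram n} (h : loops d d' = 0) :
    diag δ d * diag δ d' = diag δ (d.stack d') := by
  rw [diag_mul_diag, h, pow_zero, one_smul]

theorem diag_gen_mul_self (i : Fin (n - 1)) :
    diag δ (Diagram.gen i) * diag δ (Diagram.gen i) = δ • diag δ (Diagram.gen i) := by
  have h : (Diagram.gen i).pair (Sum.inr (lo i)) = Sum.inr (hi i) := by
    rw [gen_pair_inr, if_pos rfl]
  rw [diag_mul_diag, loops_gen_of_eq _ _ h, stack_gen_of_eq _ _ h, pow_one]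

theorem diag_gen_mul_comm (i j : Fin (n - 1)) (h : (i : ℕ) + 1 < j) :
    diag δ (Diagram.gen i) * diag δ (Diagram.gen j) =
      diag δ (Diagram.gen j) * diag δ (Diagram.gen i) := by
  have h1 : loops (Diagram.gen i) (Diagram.gen j) = 0 := by
    refine loops_gen_of_ne _ _ ?_
    rw [gen_pair_inr, if_neg, if_neg]
    · simp
    all_goals simp only [Fin.ext_iff, lo_val, hi_val]; omega
  have h2 : loops (Diagram.gen j) (Diagram.gen i) = 0 := by
    refine loops_gen_of_ne _ _ ?_
    rw [gen_pair_inr, if_neg, if_neg]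
    · simp
    all_goals simp only [Fin.ext_iff, lo_val, hi_val]; omega
  rw [diag_mul_gen_of_loops δ h1, diag_mul_gen_of_loops δ h2, gen_stack_gen_comm i j h]

theorem diag_gen_mul_mul (i j : Fin (n - 1)) (h : (i : ℕ) + 1 = j ∨ (j : ℕ) + 1 = i) :
    diag δ (Diagram.gen i) * diag δ (Diagram.gen j) * diag δ (Diagram.gen i) =
      diag δ (Diagram.gen i) := by
  have h1 : ∀ i j : Fin (n - 1), (i : ℕ) + 1 = j ∨ (j : ℕ) + 1 = i →
      (Diagram.gen i).pair (Sum.inr (lo j)) ≠ Sum.inr (hi j) := by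
    intro i j h
    rw [gen_pair_inr]
    split_ifs <;> simp only [ne_eq, Sum.inr.injEq, Fin.ext_iff, lo_val, hi_val, reduceCtorEq,
      not_false_eq_true] at * <;> omega
  have h2 : ((Diagram.gen i).stack (Diagram.gen j)).pair (Sum.inr (lo i)) ≠ Sum.inr (hi i) := by
    intro h2
    -- otherwise stacking with the generator `i` would not change this diagram
    have h3 := stack_gen_of_eq _ _ h2
    rw [gen_stack_gen_stack_gen i j h] at h3
    have h4 := stack_gen_pair_lo (Diagram.gen i) j
    rw [← h3] at h4
    exact h1 i j h h4
  rw [diag_mul_gen_of_loops δ (loops_gen_of_ne _ _ (h1 i j h)),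
    diag_mul_gen_of_loops δ (loops_gen_of_ne _ _ h2), gen_stack_gen_stack_gen i j h]

/-- The extension of a finite family by zero to all natural numbers. -/
def extendZero {A : Type*} [Zero A] {m : ℕ} (g : Fin m → A) (i : ℕ) : A :=
  if h : i < m then g ⟨i, h⟩ else 0

theorem extendZero_of_lt {A : Type*} [Zero A] {m : ℕ} (g : Fin m → A) {i : ℕ} (h : i < m) :
    extendZero g i = g ⟨i, h⟩ := dif_pos h

theorem extendZero_val {A : Type*} [Zero A] {m : ℕ} (g : Fin m → A) (i : Fin m) :
    extendZero g i = g i := dif_pos i.2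

theorem isTLFamily_extendZero {A : Type*} [Ring A] [Algebra k A] {m : ℕ} {δ : k} {g : Fin m → A}
    (hsq : ∀ i, g i * g i = δ • g i)
    (hbraid : ∀ i j : Fin m, (i : ℕ) + 1 = j ∨ (j : ℕ) + 1 = i → g i * g j * g i = g i)
    (hcomm : ∀ i j : Fin m, (i : ℕ) + 1 < j → g i * g j = g j * g i) :
    IsTLFamily δ m (extendZero g) where
  sq i := by
    by_cases h : i < m
    · rw [extendZero_of_lt g h, hsq]
    · simp [extendZero, h]
  up i h := by
    rw [extendZero_of_lt g h, extendZero_of_lt g (show i < m by omega)]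
    exact hbraid _ _ (Or.inl rfl)
  down i h := by
    rw [extendZero_of_lt g h, extendZero_of_lt g (show i < m by omega)]
    exact hbraid _ _ (Or.inr rfl)
  comm i j hij := by
    by_cases h : j < m
    · rw [extendZero_of_lt g h, extendZero_of_lt g (show i < m by omega)]
      exact hcomm _ _ hij
    · rw [show extendZero g j = 0 from dif_neg h]
      exact Commute.zero_right _

theorem isTLFamily_diag (n : ℕ) : IsTLFamily δ (n - 1)
    (extendZero fun i : Fin (n - 1) => diag δ (Diagram.gen i)) :=
  isTLFamily_extendZero (diag_gen_mul_self δ) (diag_gen_mul_mul δ) (diag_gen_mul_comm δ)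

theorem isTLFamily_gen (n : ℕ) : IsTLFamily δ (n - 1)
    (extendZero fun i : Fin (n - 1) => (gen δ i : TL n δ)) := by
  refine isTLFamily_extendZero (fun i => ?_) (fun i j h => ?_) (fun i j h => ?_)
  · exact ((map_mul _ _ _).symm.trans (RingQuot.mkAlgHom_rel k (Rel.sq i))).trans (map_smul _ _ _)
  · refine Eq.trans ?_ (RingQuot.mkAlgHom_rel k (Rel.braid (δ := δ) i j h))
    rw [map_mul, map_mul]; rfl
  · have := RingQuot.mkAlgHom_rel k (Rel.comm (δ := δ) i j (Or.inl h))
    rw [map_mul, map_mul] at this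
    exact this

/-- The natural homomorphism from the Temperley-Lieb algebra to the diagram algebra. -/
noncomputable def toDiagramAlgebra (n : ℕ) : TL n δ →ₐ[k] DiagramAlgebra n δ :=
  RingQuot.liftAlgHom k ⟨FreeAlgebra.lift k fun i => diag δ (Diagram.gen i), by
    rintro _ _ (i | ⟨i, j, h⟩ | ⟨i, j, h⟩)
    · rw [map_mul, map_smul, FreeAlgebra.lift_ι_apply, diag_gen_mul_self]
    · rw [map_mul, map_mul, FreeAlgebra.lift_ι_apply, FreeAlgebra.lift_ι_apply,
        diag_gen_mul_mul δ i j h]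
    · rw [map_mul, map_mul, FreeAlgebra.lift_ι_apply, FreeAlgebra.lift_ι_apply]
      rcases h with h | h
      · exact diag_gen_mul_comm δ i j h
      · exact (diag_gen_mul_comm δ j i h).symm⟩

theorem toDiagramAlgebra_gen (i : Fin (n - 1)) :
    toDiagramAlgebra δ n (gen δ i) = diag δ (Diagram.gen i) := by
  refine (RingQuot.liftAlgHom_mkAlgHom_apply k _ _ _).trans ?_
  exact FreeAlgebra.lift_ι_apply _ _

theorem diag_stackDesc {d : Diagram n} {J K : Set ℕ} {j : ℕ} (hj : j < n - 1)
    (h : HasEnds d j J K) (t l : ℕ) (hl : l + t = j + 1) (hK : ∀ x ∈ K, x < l) :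
    diag δ d * descProd (extendZero fun i : Fin (n - 1) => diag δ (Diagram.gen i)) l t =
      diag δ (d.stackDesc l t) := by
  induction t generalizing l with
  | zero => rw [descProd, mul_one, Diagram.stackDesc]
  | succ t ih =>
    rw [descProd_succ_right, ← mul_assoc,
      ih (l + 1) (by omega) (fun x hx => (hK x hx).trans (by omega)),
      extendZero_of_lt _ (show l < n - 1 by omega), Diagram.stackDesc,
      genDiagram_val ⟨l, by omega⟩]
    refine diag_mul_gen_of_loops δ ?_
    rw [← genDiagram_val]
    exact (h.stackDesc hj t l (by omega) hK).1

/-- No loops are formed when the generators in a word in Jones normal form are stacked. -/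
theorem chainProd_diag {m r : ℕ} {b : List (ℕ × ℕ)} (h : Chain m r b) (hm : m ≤ n - 1) :
    chainProd (extendZero fun i : Fin (n - 1) => diag δ (Diagram.gen i)) b =
      diag δ (chainDiagram n b) := by
  induction h with
  | nil => rfl
  | @cons m r j l b hb hlj hj hl ih =>
    rw [chainProd, chainDiagram, ih (by omega)]
    exact diag_stackDesc δ (by omega) (hasEnds_chainDiagram hb (by omega)) _ _ (by omega)
      (fun x hx => hb.snd_lt hx)

end Family

/-! ### Diagrams are stacks of generators -/

section Generation

variable {n : ℕ}

/-- The position of a marked point on the boundary of the strip, starting from the top left. -/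
def pos : Vertex n → ℕ := Sum.elim (fun i => i) (fun i => 2 * n - 1 - i)

@[simp] theorem pos_inl (i : Fin n) : pos (Sum.inl i : Vertex n) = i := rfl

@[simp] theorem pos_inr (i : Fin n) : pos (Sum.inr i : Vertex n) = 2 * n - 1 - i := rfl

theorem pos_injective : Function.Injective (pos : Vertex n → ℕ) := by
  rintro (i | i) (j | j) h <;> simp only [pos_inl, pos_inr] at h <;>
    simp only [Sum.inl.injEq, Sum.inr.injEq, reduceCtorEq] <;> omega

theorem before_iff_pos (u v : Vertex n) : Before u v ↔ pos u < pos v := by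
  rcases u with i | i <;> rcases v with j | j <;>
    simp only [Before, pos_inl, pos_inr, true_iff, false_iff, Fin.lt_def] <;> omega

theorem Diagram.pos_planar (d : Diagram n) (u v : Vertex n) :
    ¬ (pos u < pos v ∧ pos v < pos (d.pair u) ∧ pos (d.pair u) < pos (d.pair v)) := by
  simpa only [before_iff_pos] using d.planar u v

/-- The points between the two points of a block are joined to each other. -/
theorem Diagram.pos_pair_mem (d : Diagram n) {u v : Vertex n} (h1 : pos u < pos v)
    (h2 : pos v < pos (d.pair u)) :
    pos u < pos (d.pair v) ∧ pos (d.pair v) < pos (d.pair u) := by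
  have h3 := d.pos_planar u v
  have h4 := d.pos_planar (d.pair v) u
  rw [d.pair_pair] at h4
  have h5 : pos (d.pair v) ≠ pos u := fun h => by
    rw [← pos_injective h, d.pair_pair] at h2
    omega
  have h6 : pos (d.pair v) ≠ pos (d.pair u) := fun h => by
    rw [d.pair_inj.mp (pos_injective h)] at h1
    omega
  omega

theorem eq_one_of_forall_col_le (d : Diagram n)
    (h : ∀ i : Fin n, col (d.pair (Sum.inr i)) ≤ i) : d = Diagram.one n := by
  have key : ∀ m, ∀ i : Fin n, (i : ℕ) = m → d.pair (Sum.inr i) = Sum.inl i := by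
    intro m
    induction m using Nat.strong_induction_on with
    | _ m ih =>
      rintro i rfl
      have h1 := h i
      rcases h2 : d.pair (Sum.inr i) with j | j
      · rw [h2, col_inl] at h1
        rcases h1.lt_or_eq with h3 | h3
        · have h4 := ih j h3 j rfl
          rw [d.pair_eq_comm, ← h2, d.pair_pair] at h4
          simp at h4
          omega
        · rw [Fin.ext h3]
      · rw [h2, col_inr] at h1
        rcases h1.lt_or_eq with h3 | h3
        · have h4 := ih j h3 j rfl
          rw [← h2, d.pair_pair] at h4
          simp at h4
        · rw [Fin.ext h3] at h2
          exact absurd h2 (d.pair_ne _)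
  ext1
  funext v
  rcases v with i | i
  · exact (d.pair_eq_comm).mp (key _ i rfl)
  · exact key _ i rfl

/-- If `i` is the last bottom point whose partner lies in a column further right, then it is joined
to its right neighbour. -/
theorem exists_pair_lo_eq_hi (d : Diagram n) {i : Fin n} (h : i < col (d.pair (Sum.inr i)))
    (hmax : ∀ i' : Fin n, i < i' → col (d.pair (Sum.inr i')) ≤ i') :
    ∃ l : Fin (n - 1), i = lo l ∧ d.pair (Sum.inr (lo l)) = Sum.inr (hi l) := by
  have hn : (i : ℕ) + 1 < n := by
    rcases h2 : d.pair (Sum.inr i) with j | j <;> rw [h2] at h <;> simp at h <;> omega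
  refine ⟨⟨i, by omega⟩, rfl, ?_⟩
  obtain ⟨l, hl⟩ : ∃ l : Fin (n - 1), l = ⟨i, by omega⟩ := ⟨_, rfl⟩
  rw [← hl]
  obtain rfl : i = lo l := by rw [hl]; rfl
  have h1 := hmax (hi l) (by simp [Fin.lt_def, lo_val, hi_val])
  have hne := d.pair_ne (Sum.inr (hi l))
  rw [hi_val] at h1
  rw [lo_val] at h hn
  by_contra hcon
  have h2 := d.pos_pair_mem (u := d.pair (Sum.inr (lo l))) (v := Sum.inr (hi l))
  rw [d.pair_pair] at h2
  rcases hw : d.pair (Sum.inr (lo l)) with m | m <;> rw [hw] at h hcon h2 <;>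
    rcases hx : d.pair (Sum.inr (hi l)) with x | x <;> rw [hx] at h1 h2 hne <;>
    simp only [col_inl, col_inr, pos_inl, pos_inr, ne_eq, Sum.inr.injEq, Fin.ext_iff, lo_val,
      hi_val] at * <;> omega

/-- The number of points on each side of a block is even, which excludes a strand from a top point
to the bottom point in the next column. -/
theorem pair_inr_ne_inl (d : Diagram n) {i j : Fin n} (h : (j : ℕ) = i + 1) :
    d.pair (Sum.inr j) ≠ Sum.inl i := by
  intro hp
  have hp' := (d.pair_eq_comm).mp hp
  have mem : ∀ v : Vertex n,
      pos (Sum.inl i : Vertex n) < pos v ∧ pos v < pos (Sum.inr j : Vertex n) →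
      pos (Sum.inl i : Vertex n) < pos (d.pair v) ∧
        pos (d.pair v) < pos (Sum.inr j : Vertex n) := by
    rintro v ⟨h1, h2⟩
    have := d.pos_pair_mem (u := Sum.inl i) h1 (by rwa [hp'])
    rwa [hp'] at this
  -- add up modulo two the indicator function of the points between the two points of the block
  have hs := sum_eq_zero_of_pair d (fun v => if pos (Sum.inl i : Vertex n) < pos v ∧
    pos v < pos (Sum.inr j : Vertex n) then 1 else 0) (fun v => by
      have h1 := mem v
      have h2 := mem (d.pair v)
      rw [d.pair_pair] at h2
      simp only [show _ ↔ _ from ⟨h2, h1⟩])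
  have h1 : ∀ x : Fin n, (i : ℕ) < x ∧ (x : ℕ) < 2 * n - 1 - j ↔ (i : ℕ) < x := by
    intro x; omega
  have h2 : ∀ x : Fin n, (i : ℕ) < 2 * n - 1 - x ∧ 2 * n - 1 - (x : ℕ) < 2 * n - 1 - j ↔
      (j : ℕ) < x := by
    intro x; omega
  simp only [Fintype.sum_sum_type, pos_inl, pos_inr, h1, h2] at hs
  rw [← Finset.sum_add_distrib, Finset.sum_eq_single j] at hs
  · simp [h] at hs
  · intro x _ hx
    have := Fin.val_ne_of_ne hx
    split_ifs <;> first | rfl | (exfalso; omega)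
  · simp

/-- Straightening column `l + 1`: if the bottom points `l` and `l + 1` are joined, then the top
point `l + 1` can be joined to the bottom point `l + 1` instead, and its partner to the bottom point
`l`, provided that no strand leaves the part of the strip to the right of this column. -/
theorem exists_straighten (d : Diagram n) (l : Fin (n - 1))
    (hl : d.pair (Sum.inr (lo l)) = Sum.inr (hi l))
    (hc : ∀ v, (l : ℕ) + 1 < col v → (l : ℕ) + 1 < col (d.pair v)) :
    ∃ d' : Diagram n, d'.stack (Diagram.gen l) = d ∧ col (d'.pair (Sum.inr (lo l))) ≤ l ∧
      d'.pair (Sum.inr (hi l)) = Sum.inl (hi l) := by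
  obtain ⟨q, hq⟩ : ∃ q, d.pair (Sum.inl (hi l)) = q := ⟨_, rfl⟩
  have hl' := (d.pair_eq_comm).mp hl
  have hq' := (d.pair_eq_comm).mp hq
  have hlh := lo_ne_hi l
  have q1 : q ≠ Sum.inr (hi l) := by rintro rfl; rw [hl'] at hq'; simp at hq'
  have q2 : q ≠ Sum.inr (lo l) := by rintro rfl; rw [hl] at hq'; simp at hq'
  have q3 : q ≠ Sum.inl (hi l) := by rw [← hq]; exact d.pair_ne _
  have hql : col q ≤ l := by
    have h1 := hc q
    rw [hq', col_inl, hi_val] at h1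
    rcases q with x | x <;> simp [Fin.ext_iff, hi_val] at q1 q2 q3 h1 ⊢ <;> omega
  let f : Vertex n → Vertex n := fun v => if v = Sum.inr (hi l) then Sum.inl (hi l)
    else if v = Sum.inl (hi l) then Sum.inr (hi l) else if v = Sum.inr (lo l) then q
    else if v = q then Sum.inr (lo l) else d.pair v
  have f1 : f (Sum.inr (hi l)) = Sum.inl (hi l) := by simp [f]
  have f2 : f (Sum.inl (hi l)) = Sum.inr (hi l) := by simp [f]
  have f3 : f (Sum.inr (lo l)) = q := by simp [f, hlh]
  have f4 : f q = Sum.inr (lo l) := by simp [f, q1, q2, q3]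
  have f5 : ∀ v, v ≠ Sum.inr (hi l) → v ≠ Sum.inl (hi l) → v ≠ Sum.inr (lo l) → v ≠ q →
      f v = d.pair v := fun v h1 h2 h3 h4 => by simp [f, h1, h2, h3, h4]
  have fcases : ∀ v, v = Sum.inr (hi l) ∨ v = Sum.inl (hi l) ∨ v = Sum.inr (lo l) ∨ v = q ∨
      (v ≠ Sum.inr (hi l) ∧ v ≠ Sum.inl (hi l) ∧ v ≠ Sum.inr (lo l) ∧ v ≠ q) := by
    intro v; tauto
  have dcases : ∀ v, v ≠ Sum.inr (hi l) → v ≠ Sum.inl (hi l) → v ≠ Sum.inr (lo l) → v ≠ q →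
      d.pair v ≠ Sum.inr (hi l) ∧ d.pair v ≠ Sum.inl (hi l) ∧ d.pair v ≠ Sum.inr (lo l) ∧
        d.pair v ≠ q := by
    refine fun v h1 h2 h3 h4 => ⟨fun h => h3 ?_, fun h => h4 ?_, fun h => h1 ?_, fun h => h2 ?_⟩
    · rw [← (d.pair_eq_comm).mp h, hl']
    · rw [← (d.pair_eq_comm).mp h, hq]
    · rw [← (d.pair_eq_comm).mp h, hl]
    · rw [← (d.pair_eq_comm).mp h, hq']
  -- the positions of the four points, and of the other points relative to them
  have hpos : ∀ v : Vertex n, pos v < 2 * n := by rintro (x | x) <;> simp <;> omega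
  have hln : (l : ℕ) + 1 < n := by omega
  have pA : pos (Sum.inr (hi l) : Vertex n) = 2 * n - 1 - (l + 1) := rfl
  have pB : pos (Sum.inr (lo l) : Vertex n) = 2 * n - 1 - l := rfl
  have pC : pos (Sum.inl (hi l) : Vertex n) = l + 1 := rfl
  have pcol : ∀ v : Vertex n, (l : ℕ) + 1 < col v ↔
      (l : ℕ) + 1 < pos v ∧ pos v < 2 * n - 1 - (l + 1) := by
    rintro (x | x) <;> simp <;> omega
  have pQ : pos q < l + 1 ∨ 2 * n - 1 - l < pos q := by
    have h1 := (pcol q).not.mp (by omega)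
    have h2 := pos_injective.ne q1
    have h3 := pos_injective.ne q2
    have h4 := pos_injective.ne q3
    omega
  have generic : ∀ v, v ≠ Sum.inr (hi l) ∧ v ≠ Sum.inl (hi l) ∧ v ≠ Sum.inr (lo l) ∧ v ≠ q →
      (pos v ≠ pos q ∧ pos v ≠ l + 1 ∧ pos v ≠ 2 * n - 1 - l ∧ pos v ≠ 2 * n - 1 - (l + 1)) := by
    rintro v ⟨h1, h2, h3, h4⟩
    have := pos_injective.ne h1
    have := pos_injective.ne h2
    have := pos_injective.ne h3
    have := pos_injective.ne h4
    omega
  have reg : ∀ v, ((l : ℕ) + 1 < pos v ∧ pos v < 2 * n - 1 - (l + 1)) →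
      ((l : ℕ) + 1 < pos (d.pair v) ∧ pos (d.pair v) < 2 * n - 1 - (l + 1)) := fun v hv =>
    (pcol _).mp (hc v ((pcol v).mpr hv))
  have cr := d.pos_planar
  let d' : Diagram n :=
    { pair := f
      pair_pair := by
        intro v
        rcases fcases v with rfl | rfl | rfl | rfl | ⟨h1, h2, h3, h4⟩
        · rw [f1, f2]
        · rw [f2, f1]
        · rw [f3, f4]
        · rw [f4, f3]
        · obtain ⟨g1, g2, g3, g4⟩ := dcases v h1 h2 h3 h4
          rw [f5 v h1 h2 h3 h4, f5 _ g1 g2 g3 g4, d.pair_pair]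
      pair_ne := by
        intro v
        rcases fcases v with rfl | rfl | rfl | rfl | ⟨h1, h2, h3, h4⟩
        · rw [f1]; simp
        · rw [f2]; simp
        · rw [f3]; exact q2
        · rw [f4]; exact q2.symm
        · rw [f5 v h1 h2 h3 h4]; exact d.pair_ne v
      planar := by
        intro u v
        simp only [before_iff_pos]
        -- the block of a further point `v` stays on one side of column `l + 1`, and does not
        -- cross the former block of `q`
        have key : ∀ v, v ≠ Sum.inr (hi l) ∧ v ≠ Sum.inl (hi l) ∧ v ≠ Sum.inr (lo l) ∧ v ≠ q →
            f v = d.pair v ∧ pos v < 2 * n ∧ pos (d.pair v) < 2 * n ∧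
            (pos v ≠ pos q ∧ pos v ≠ l + 1 ∧ pos v ≠ 2 * n - 1 - l ∧
              pos v ≠ 2 * n - 1 - (l + 1)) ∧
            (pos (d.pair v) ≠ pos q ∧ pos (d.pair v) ≠ l + 1 ∧ pos (d.pair v) ≠ 2 * n - 1 - l ∧
              pos (d.pair v) ≠ 2 * n - 1 - (l + 1)) ∧
            (((l : ℕ) + 1 < pos v ∧ pos v < 2 * n - 1 - (l + 1)) ↔
            ((l : ℕ) + 1 < pos (d.pair v) ∧ pos (d.pair v) < 2 * n - 1 - (l + 1))) ∧
            ¬ (pos v < l + 1 ∧ l + 1 < pos (d.pair v) ∧ pos (d.pair v) < pos q) ∧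
            ¬ (pos v < pos q ∧ pos q < pos (d.pair v) ∧ pos (d.pair v) < l + 1) ∧
            ¬ (l + 1 < pos v ∧ pos v < pos q ∧ pos q < pos (d.pair v)) ∧
            ¬ (pos q < pos v ∧ pos v < l + 1 ∧ l + 1 < pos (d.pair v)) := by
          rintro v hv
          obtain ⟨h1, h2, h3, h4⟩ := hv
          have hg := dcases v h1 h2 h3 h4
          have r1 := reg v
          have r2 := reg (d.pair v)
          rw [d.pair_pair] at r2
          have c1 := cr v (Sum.inl (hi l))
          have c2 := cr v q
          have c3 := cr (Sum.inl (hi l)) v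
          have c4 := cr q v
          rw [hq, pC] at c1 c3
          rw [hq', pC] at c2 c4
          exact ⟨f5 v h1 h2 h3 h4, hpos _, hpos _, generic v ⟨h1, h2, h3, h4⟩, generic _ hg,
            ⟨r1, r2⟩, c1, c2, c3, c4⟩
        rcases fcases u with hu | hu | hu | hu | hu <;>
          rcases fcases v with hv | hv | hv | hv | hv <;>
          first
          | (have ku := key u hu
             have kv := key v hv
             have := cr u v
             rw [ku.1, kv.1]
             exact this)
          | (have ku := key u hu
             rw [ku.1, hv]
             simp only [f1, f2, f3, f4, pA, pB, pC]
             omega)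
          | (have kv := key v hv
             rw [kv.1, hu]
             simp only [f1, f2, f3, f4, pA, pB, pC]
             omega)
          | (rw [hu, hv]
             simp only [f1, f2, f3, f4, pA, pB, pC]
             omega) }
  refine ⟨d', ?_, (congrArg col f3).trans_le hql, f1⟩
  ext1
  funext v
  rw [stack_gen_pair]
  change (if _ then _ else if _ then _ else if f v = _ then f _ else if f v = _ then f _ else f v)
    = _
  rw [f1, f3]
  rcases fcases v with rfl | rfl | rfl | rfl | ⟨h1, h2, h3, h4⟩
  · rw [if_neg (by simpa using hlh.symm), if_pos rfl, hl']
  · rw [f2, if_neg (by simp), if_neg (by simp), if_neg (by simpa using hlh.symm), if_pos rfl, hq]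
  · rw [if_pos rfl, hl]
  · rw [f4, if_neg q2, if_neg q1, if_pos rfl, hq']
  · obtain ⟨g1, g2, g3, g4⟩ := dcases v h1 h2 h3 h4
    rw [f5 v h1 h2 h3 h4, if_neg h3, if_neg h1, if_neg g3, if_neg g1]

/-- Splitting off a generator at the last bottom point whose partner lies in a column further
right. In the upper factor this property passes from the bottom point `l` to the bottom point
`l + 1`, or is lost. -/
theorem exists_stack_gen_eq (d : Diagram n) (l : Fin (n - 1))
    (hl : d.pair (Sum.inr (lo l)) = Sum.inr (hi l))
    (hmax : ∀ i : Fin n, lo l < i → col (d.pair (Sum.inr i)) ≤ i) :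
    ∃ d' : Diagram n, d'.stack (Diagram.gen l) = d ∧ col (d'.pair (Sum.inr (lo l))) ≤ l ∧
      (d'.pair (Sum.inr (hi l)) = Sum.inl (hi l) ∨
        ∃ c : Fin n, (c : ℕ) = l + 2 ∧ d'.pair (Sum.inr (hi l)) = Sum.inr c) := by
  by_cases h : ∃ l' : Fin (n - 1), (l' : ℕ) = l + 1 ∧ d.pair (Sum.inr (hi l')) ≠ Sum.inl (hi l')
  · -- the arc can be moved one step to the right, as `e_l e_{l+1} e_l = e_l`
    obtain ⟨l', hl', hs⟩ := h
    have hlo : lo l' = hi l := Fin.ext hl'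
    have hne := lo_ne_hi l
    have hll : lo l ≠ hi l' := by simp only [ne_eq, Fin.ext_iff, lo_val, hi_val]; omega
    refine ⟨d.stack (Diagram.gen l'), ?_, ?_, Or.inr ⟨hi l', by rw [hi_val, hl'], ?_⟩⟩
    · nth_rewrite 1 [← stack_gen_of_eq d l hl]
      rw [stack_assoc, stack_assoc, ← stack_assoc (Diagram.gen l),
        gen_stack_gen_stack_gen l l' (Or.inl hl'.symm), stack_gen_of_eq d l hl]
    · have h1 := hmax (hi l') (by simp only [Fin.lt_def, lo_val, hi_val]; omega)
      have h2 := pair_inr_ne_inl d (i := hi l) (j := hi l') (by simp only [hi_val]; omega)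
      have h3 := d.pair_ne (Sum.inr (hi l'))
      have h4 : d.pair (Sum.inr (hi l')) ≠ Sum.inr (hi l) := by
        rw [← hl, ne_eq, d.pair_inj]
        simpa using hll.symm
      rw [stack_gen_pair, hlo, if_neg (by simpa using hne), if_neg (by simpa using hll), if_pos hl]
      rcases hx : d.pair (Sum.inr (hi l')) with x | x <;> rw [hx] at h1 h2 h3 h4 hs <;>
        simp [Fin.ext_iff, hi_val] at h1 h2 h3 h4 hs ⊢ <;> omega
    · rw [← hlo, stack_gen_pair_lo]
  · push Not at h
    -- column `l + 2` is vertical or missing, so that column `l + 1` can be straightened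
    obtain ⟨d', h1, h2, h3⟩ := exists_straighten d l hl (fun v hv => by
      have hn : (l : ℕ) + 1 < n - 1 := by rcases v with x | x <;> simp at hv <;> omega
      have hs := h ⟨l + 1, hn⟩ rfl
      have hs' := (d.pair_eq_comm).mp hs
      obtain ⟨c, hc⟩ : ∃ c, c = (hi ⟨l + 1, hn⟩ : Fin n) := ⟨_, rfl⟩
      have hcv : (c : ℕ) = l + 2 := by rw [hc]; rfl
      rw [← hc] at hs hs'
      by_cases e1 : v = Sum.inl c
      · rw [e1, hs', col_inr]; omega
      by_cases e2 : v = Sum.inr c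
      · rw [e2, hs, col_inl]; omega
      have h5 := d.pos_pair_mem (u := Sum.inl c) (v := v)
      rw [hs'] at h5
      rcases v with x | x <;> rcases hx : d.pair _ with y | y <;> rw [hx] at h5 <;>
        simp [Fin.ext_iff] at e1 e2 h5 hv ⊢ <;> omega)
    exact ⟨d', h1, h2, Or.inl h3⟩

/-- The sum over the bottom points whose partner lies in a column further right of their distances
to the right end. It is the measure of the induction that splits off generators. -/
def rightWeight (d : Diagram n) : ℕ :=
  ∑ i : Fin n, if i < col (d.pair (Sum.inr i)) then n - i else 0

theorem rightWeight_lt (d : Diagram n) (l : Fin (n - 1)) (hp : col (d.pair (Sum.inr (lo l))) ≤ l)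
    (hq : d.pair (Sum.inr (hi l)) = Sum.inl (hi l) ∨
      ∃ c : Fin n, (c : ℕ) = l + 2 ∧ d.pair (Sum.inr (hi l)) = Sum.inr c) :
    rightWeight d < rightWeight (d.stack (Diagram.gen l)) := by
  have hq' : (l : ℕ) + 1 ≤ col (d.pair (Sum.inr (hi l))) := by
    rcases hq with h | ⟨c, hc, h⟩ <;> rw [h]
    · rfl
    · rw [col_inr]; omega
  -- the summand `n - l` of the stack takes the place of at most a summand `n - (l + 1)` of `d`
  have key : ∀ i : Fin n, (if i < col (d.pair (Sum.inr i)) then n - i else 0) +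
      (if i = lo l then n - (l : ℕ) else 0) ≤
      (if i < col ((d.stack (Diagram.gen l)).pair (Sum.inr i)) then n - i else 0) +
      (if i = hi l then n - (l + 1 : ℕ) else 0) := by
    intro i
    by_cases h1 : i = lo l
    · rw [if_pos h1, h1, stack_gen_pair_lo, col_inr, lo_val, hi_val, if_neg (by omega),
        if_pos (by omega)]
      omega
    by_cases h2 : i = hi l
    · rw [if_neg h1, if_pos h2, h2, hi_val]
      split_ifs <;> omega
    rw [if_neg h1, if_neg h2]
    by_cases h3 : Sum.inr i = d.pair (Sum.inr (hi l))
    · rw [h3, d.pair_pair, if_neg]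
      · simp
      · rw [← h3, col_inr] at hq'
        simp only [col_inr, hi_val]
        omega
    · simp only [col_stack_gen_pair_inr d l hp hq' i h1 h2 h3, le_refl]
  have hsum := Finset.sum_le_sum fun i (_ : i ∈ Finset.univ) => key i
  rw [Finset.sum_add_distrib, Finset.sum_add_distrib, Finset.sum_ite_eq', Finset.sum_ite_eq',
    if_pos (Finset.mem_univ _), if_pos (Finset.mem_univ _)] at hsum
  change rightWeight d + _ ≤ rightWeight _ + _ at hsum
  omega

/-- Every diagram is a stack of generating diagrams. -/
theorem Diagram.induction_stack_gen {P : Diagram n → Prop} (h1 : P (Diagram.one n))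
    (h2 : ∀ d l, P d → P (d.stack (Diagram.gen l))) (d : Diagram n) : P d := by
  induction hw : rightWeight d using Nat.strong_induction_on generalizing d with
  | _ w ih =>
    subst hw
    by_cases h : ∃ i : Fin n, i < col (d.pair (Sum.inr i))
    · obtain ⟨i, hi1, hi2⟩ := Finset.exists_max_image
        (Finset.univ.filter fun i : Fin n => i < col (d.pair (Sum.inr i))) id
        (by simpa [Finset.filter_nonempty_iff] using h)
      simp only [Finset.mem_filter, Finset.mem_univ, true_and, id] at hi1 hi2
      have hmax : ∀ i' : Fin n, i < i' → col (d.pair (Sum.inr i')) ≤ i' := fun i' hi' =>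
        not_lt.mp fun hlt => absurd (hi2 i' hlt) (not_le.mpr hi')
      obtain ⟨l, rfl, hl⟩ := exists_pair_lo_eq_hi d hi1 hmax
      obtain ⟨d', rfl, hp, hq⟩ := exists_stack_gen_eq d l hl hmax
      exact h2 d' l (ih _ (rightWeight_lt d' l hp hq) d' rfl)
    · push Not at h
      rw [eq_one_of_forall_col_le d h]
      exact h1

end Generation

/-! ### The isomorphism -/

section Words

theorem chain_iff {m r : ℕ} {c : List (ℕ × ℕ)} : Chain m r c ↔
    c.Pairwise (fun x y => y.1 < x.1 ∧ y.2 < x.2) ∧ (∀ x ∈ c, x.2 ≤ x.1) ∧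
      ∀ x ∈ c, x.1 < m ∧ x.2 < r := by
  constructor
  · intro h
    refine ⟨?_, ?_, h.lt⟩
    · induction h with
      | nil => exact .nil
      | cons hb _ _ _ ih => exact .cons hb.lt ih
    · induction h with
      | nil => simp
      | cons _ hlj _ _ ih => simpa using ⟨hlj, fun a b => ih (a, b)⟩
  · intro h
    induction c generalizing m r with
    | nil => exact .nil _ _
    | cons x c ih =>
      obtain ⟨h1, h2, h3⟩ := h
      rw [List.pairwise_cons] at h1
      rw [List.forall_mem_cons] at h2 h3
      exact .cons (ih ⟨h1.2, h2.2, h1.1⟩) h2.1 h3.1.1 h3.1.2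

/-- The chain of the list of the pairs of ends of the descending factors. -/
def toChain {m : ℕ} (b : List (Fin m × Fin m)) : List (ℕ × ℕ) :=
  (b.map (Prod.map Fin.val Fin.val)).reverse

theorem toChain_injective {m : ℕ} :
    Function.Injective (toChain : List (Fin m × Fin m) → List (ℕ × ℕ)) :=
  List.reverse_injective.comp
    (List.map_injective_iff.mpr (Fin.val_injective.prodMap Fin.val_injective))

theorem chain_toChain_iff {m : ℕ} (b : List (Fin m × Fin m)) : Chain m m (toChain b) ↔
    b.Pairwise (fun x y => x.1 < y.1 ∧ x.2 < y.2) ∧ ∀ x ∈ b, x.2 ≤ x.1 := by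
  rw [chain_iff, toChain, List.pairwise_reverse, List.pairwise_map]
  simp only [Prod.map_fst, Prod.map_snd, List.mem_reverse, List.forall_mem_map, Fin.is_lt,
    and_self, implies_true, and_true]
  rfl

theorem exists_toChain_eq {m : ℕ} {c : List (ℕ × ℕ)} (h : Chain m m c) :
    ∃ b : List (Fin m × Fin m), toChain b = c := by
  have : c.reverse ∈
      Set.range (List.map (Prod.map (Fin.val : Fin m → ℕ) (Fin.val : Fin m → ℕ))) := by
    rw [Set.range_list_map]
    intro x hx
    have := h.lt x (by simpa using hx)
    exact ⟨(⟨x.1, this.1⟩, ⟨x.2, this.2⟩), rfl⟩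
  obtain ⟨b, hb⟩ := this
  exact ⟨b, by rw [toChain, hb, List.reverse_reverse]⟩

theorem map_val_descWord {m : ℕ} (j l : Fin m) :
    (descWord j l).map Fin.val = (List.range' l (j + 1 - l)).reverse := by
  rw [descWord, List.map_reverse]
  congr 1
  refine List.Perm.eq_of_pairwise (le := (· < ·)) (fun a b _ _ h1 h2 => absurd h1 h2.asymm) ?_ ?_ ?_
  · rw [List.pairwise_map]
    exact (List.pairwise_lt_finRange m).filter _
  · exact List.pairwise_lt_range'
  · rw [List.perm_ext_iff_of_nodup]
    · intro a
      simp only [List.mem_map, List.mem_filter, List.mem_finRange, true_and, decide_eq_true_eq,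
        List.mem_range'_1, Fin.le_def]
      constructor
      · rintro ⟨i, hi, rfl⟩
        omega
      · intro h
        exact ⟨⟨a, by omega⟩, by simp only; omega, rfl⟩
    · exact ((List.nodup_finRange m).filter _).map Fin.val_injective
    · exact List.nodup_range'

theorem prod_map_descWord {A : Type*} [Ring A] {m : ℕ} (g : Fin m → A) (j l : Fin m) :
    ((descWord j l).map g).prod = descProd (extendZero g) l (j + 1 - l) := by
  have h : (descWord j l).map g = ((descWord j l).map Fin.val).map (extendZero g) := by
    rw [List.map_map]
    exact List.map_congr_left fun i _ => (extendZero_val g i).symm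
  rw [h, map_val_descWord]
  generalize (j + 1 - l : ℕ) = t
  generalize (l : ℕ) = l
  induction t generalizing l with
  | zero => rfl
  | succ t ih =>
    rw [descProd_succ_right, ← ih, List.range'_succ, List.reverse_cons, List.map_append,
      List.prod_append]
    simp

theorem chainProd_toChain {A : Type*} [Ring A] {m : ℕ} (g : Fin m → A)
    (b : List (Fin m × Fin m)) :
    ((b.flatMap fun x => descWord x.1 x.2).map g).prod = chainProd (extendZero g) (toChain b) := by
  induction b using List.reverseRecOn with
  | nil => rfl
  | append_singleton b x ih =>
    rw [List.flatMap_append, List.map_append, List.prod_append, ih, List.flatMap_singleton,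
      prod_map_descWord, toChain, toChain, List.map_append, List.reverse_append]
    rfl

variable {n : ℕ}

/-- The diagram of a word in the generators: the stack of the generating diagrams, without the
loops. -/
noncomputable def wordDiagram (w : List (Fin (n - 1))) : Diagram n :=
  w.foldl (fun d i => d.stack (Diagram.gen i)) (Diagram.one n)

theorem foldl_descWord (d : Diagram n) (j l : Fin (n - 1)) :
    (descWord j l).foldl (fun d i => d.stack (Diagram.gen i)) d = d.stackDesc l (j + 1 - l) := by
  have h : (descWord j l).foldl (fun d i => d.stack (Diagram.gen i)) d =
      ((descWord j l).map Fin.val).foldl (fun d i => d.stack (genDiagram n i)) d := by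
    rw [List.foldl_map]
    simp only [genDiagram_val]
  rw [h, map_val_descWord]
  generalize (j + 1 - l : ℕ) = t
  generalize (l : ℕ) = l
  induction t generalizing l with
  | zero => rfl
  | succ t ih =>
    rw [Diagram.stackDesc, ← ih, List.range'_succ, List.reverse_cons, List.foldl_append]
    rfl

theorem wordDiagram_flatMap (b : List (Fin (n - 1) × Fin (n - 1))) :
    wordDiagram (b.flatMap fun x => descWord x.1 x.2) = chainDiagram n (toChain b) := by
  induction b using List.reverseRecOn with
  | nil => rfl
  | append_singleton b x ih =>
    rw [wordDiagram] at ih ⊢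
    rw [List.flatMap_append, List.foldl_append, ih, List.flatMap_singleton, foldl_descWord,
      toChain, toChain, List.map_append, List.reverse_append]
    rfl

end Words

section Bijection

variable {n : ℕ}

theorem diag_mem_span_iff {k : Type*} [CommRing k] [Nontrivial k] (δ : k) (S : Set (Diagram n))
    (d : Diagram n) : diag δ d ∈ Submodule.span k (diag δ '' S) ↔ d ∈ S := by
  have h : d ∈ S ↔ (Finsupp.single d 1 : Diagram n →₀ k) ∈ Finsupp.supported k k S := by
    rw [Finsupp.mem_supported, Finsupp.support_single]
    · simp
    · exact one_ne_zero
  rw [h, Finsupp.supported_eq_span_single]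
  rfl

theorem diag_one_mul_diag_one {k : Type*} [CommRing k] (d d' : Diagram n) :
    diag (1 : k) d * diag 1 d' = diag 1 (d.stack d') := by
  rw [diag_mul_diag, one_pow, one_smul]

/-- The diagrams of the words in Jones normal form exhaust all diagrams. As the words in Jones
normal form span a right ideal of the diagram algebra over the integers with `δ = 1`, a stack of
such a diagram on top of a generator is again such a diagram. -/
theorem exists_chainDiagram_eq (d : Diagram n) :
    ∃ c, Chain (n - 1) (n - 1) c ∧ chainDiagram n c = d := by
  induction d using Diagram.induction_stack_gen with
  | h1 => exact ⟨[], .nil _ _, rfl⟩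
  | h2 d l ih =>
    obtain ⟨c, hc, rfl⟩ := ih
    have h := mul_mem_jonesSpan (k := ℤ) (isTLFamily_diag (1 : ℤ) n) le_rfl _
      (chainProd_mem_jonesSpan hc) l l.2
    rw [chainProd_diag _ hc le_rfl, extendZero_val, diag_one_mul_diag_one, jonesSpan,
      Set.image_congr (s := {b | Chain (n - 1) (n - 1) b}) fun b hb =>
        chainProd_diag (1 : ℤ) hb le_rfl, ← Set.image_image, diag_mem_span_iff] at h
    exact h

theorem bijective_chainDiagram : Function.Bijective
    (fun c : {b | Chain (n - 1) (n - 1) b} => chainDiagram n c.1) :=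
  ⟨fun c c' h => Subtype.ext (chainDiagram_injOn c.2 c'.2 h), fun d =>
    let ⟨c, hc, h⟩ := exists_chainDiagram_eq d
    ⟨⟨c, hc⟩, h⟩⟩

theorem bijective_wordDiagram :
    Function.Bijective (fun w : JonesWord n => wordDiagram w.1) := by
  refine ⟨?_, fun d => ?_⟩
  · rintro ⟨_, b, h1, h2, rfl⟩ ⟨_, b', h1', h2', rfl⟩ h
    simp only [wordDiagram_flatMap] at h
    have := toChain_injective (chainDiagram_injOn ((chain_toChain_iff b).mpr ⟨h1, h2⟩)
      ((chain_toChain_iff b').mpr ⟨h1', h2'⟩) h)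
    exact Subtype.ext (congrArg (List.flatMap fun x => descWord x.1 x.2) this)
  · obtain ⟨c, hc, rfl⟩ := exists_chainDiagram_eq d
    obtain ⟨b, rfl⟩ := exists_toChain_eq hc
    obtain ⟨h1, h2⟩ := (chain_toChain_iff b).mp hc
    exact ⟨⟨_, b, h1, h2, rfl⟩, wordDiagram_flatMap b⟩

theorem card_jonesWord (hn : 0 < n) :
    (Nat.card (JonesWord n) : ℚ) = 1 / (n + 1) * (2 * n).choose n := by
  obtain ⟨m, rfl⟩ : ∃ m, n = m + 1 := ⟨n - 1, by omega⟩
  have h1 : Nat.card (JonesWord (m + 1)) = {b | Chain m m b}.ncard :=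
    (Nat.card_congr (Equiv.ofBijective _ bijective_wordDiagram)).trans
      (Nat.card_congr (Equiv.ofBijective _ bijective_chainDiagram)).symm
  have h2 := ncard_chain_eq_catalan m
  rw [h1, ← h2]
  push_cast
  have : (m : ℚ) + 1 + 1 ≠ 0 := by positivity
  field_simp
  ring

end Bijection

section Isomorphism

variable {k : Type*} [CommRing k] {n : ℕ} (δ : k)

theorem toDiagramAlgebra_wordProd (w : JonesWord n) :
    toDiagramAlgebra δ n (wordProd δ w.1) = diag δ (wordDiagram w.1) := by
  obtain ⟨_, b, h1, h2, rfl⟩ := w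
  have h : (toDiagramAlgebra δ n ∘ gen δ : Fin (n - 1) → DiagramAlgebra n δ) =
      fun i => diag δ (Diagram.gen i) := funext (toDiagramAlgebra_gen δ)
  rw [wordDiagram_flatMap, wordProd, map_list_prod, List.map_map, h, chainProd_toChain,
    chainProd_diag δ ((chain_toChain_iff b).mpr ⟨h1, h2⟩) le_rfl]

/-- The quotient map onto the Temperley-Lieb algebra. -/
def TL.mk (n : ℕ) : FreeAlgebra k (Fin (n - 1)) →ₐ[k] TL n δ := RingQuot.mkAlgHom k (Rel n δ)

theorem TL.mk_surjective : Function.Surjective (TL.mk δ n) :=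
  RingQuot.mkAlgHom_surjective k (Rel n δ)

theorem TL.algHom_ext {A : Type*} [Ring A] [Algebra k A] {f g : TL n δ →ₐ[k] A}
    (h : ∀ i, f (gen δ i) = g (gen δ i)) : f = g := by
  have h' : f.comp (TL.mk δ n) = g.comp (TL.mk δ n) := FreeAlgebra.hom_ext (funext h)
  ext x
  obtain ⟨x, rfl⟩ := TL.mk_surjective δ x
  exact DFunLike.congr_fun h' x

theorem jonesSpan_gen_eq_top :
    jonesSpan k (extendZero fun i : Fin (n - 1) => (gen δ i : TL n δ)) (n - 1) = ⊤ := by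
  have hV := mul_mem_jonesSpan (k := k) (isTLFamily_gen δ n) le_rfl
  set V := jonesSpan k (extendZero fun i : Fin (n - 1) => (gen δ i : TL n δ)) (n - 1)
  have key : ∀ x : FreeAlgebra k (Fin (n - 1)), ∀ y ∈ V,
      y * TL.mk δ n x ∈ V := by
    intro x
    induction x using FreeAlgebra.induction with
    | grade0 r =>
      intro y hy
      rw [AlgHom.commutes]
      have := V.smul_mem r hy
      rwa [Algebra.smul_def, Algebra.commutes] at this
    | grade1 i =>
      intro y hy
      have := hV y hy i i.2
      rw [extendZero_val] at this
      exact this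
    | mul a b ha hb =>
      intro y hy
      have := hb _ (ha y hy)
      rw [mul_assoc] at this
      rwa [map_mul]
    | add a b ha hb =>
      intro y hy
      have := V.add_mem (ha y hy) (hb y hy)
      rw [← mul_add] at this
      rwa [map_add]
  refine eq_top_iff.mpr fun x _ => ?_
  obtain ⟨x, rfl⟩ := TL.mk_surjective δ x
  have := key x 1 (chainProd_mem_jonesSpan (.nil _ _))
  rwa [one_mul] at this

theorem span_wordProd_eq_top :
    Submodule.span k (Set.range fun w : JonesWord n => (wordProd δ w.1 : TL n δ)) = ⊤ := by
  refine eq_top_iff.mpr ((jonesSpan_gen_eq_top δ).ge.trans (Submodule.span_mono ?_))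
  rintro _ ⟨c, hc, rfl⟩
  obtain ⟨b, rfl⟩ := exists_toChain_eq hc
  obtain ⟨h1, h2⟩ := (chain_toChain_iff b).mp hc
  exact ⟨⟨_, b, h1, h2, rfl⟩, chainProd_toChain _ b⟩

/-- The diagrams as a basis of the diagram algebra. -/
noncomputable def diagBasis (n : ℕ) : Module.Basis (Diagram n) k (DiagramAlgebra n δ) :=
  Module.Basis.ofRepr (LinearEquiv.refl k (Diagram n →₀ k))

theorem diagBasis_apply (d : Diagram n) : diagBasis δ n d = diag δ d := rfl

theorem linearIndependent_wordProd :
    LinearIndependent k fun w : JonesWord n => (wordProd δ w.1 : TL n δ) := by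
  refine LinearIndependent.of_comp (toDiagramAlgebra δ n).toLinearMap ?_
  have h := (diagBasis δ n).linearIndependent.comp _ (bijective_wordDiagram (n := n)).1
  convert h using 1
  funext w
  exact toDiagramAlgebra_wordProd δ w

/-- The words in Jones normal form as a basis of the Temperley-Lieb algebra. -/
noncomputable def jonesBasis (n : ℕ) : Module.Basis (JonesWord n) k (TL n δ) :=
  Module.Basis.mk (linearIndependent_wordProd δ) (span_wordProd_eq_top δ).ge

theorem jonesBasis_apply (w : JonesWord n) : jonesBasis δ n w = wordProd δ w.1 :=
  Module.Basis.mk_apply _ _ _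

theorem bijective_toDiagramAlgebra : Function.Bijective (toDiagramAlgebra δ n) := by
  have h : (toDiagramAlgebra δ n).toLinearMap = ((jonesBasis δ n).equiv (diagBasis δ n)
      (Equiv.ofBijective _ bijective_wordDiagram)).toLinearMap := by
    refine (jonesBasis δ n).ext fun w => ?_
    rw [AlgHom.toLinearMap_apply, LinearEquiv.coe_coe, Module.Basis.equiv_apply, diagBasis_apply,
      jonesBasis_apply, toDiagramAlgebra_wordProd]
    rfl
  change Function.Bijective (toDiagramAlgebra δ n).toLinearMap
  rw [h]
  exact LinearEquiv.bijective _

end Isomorphism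

end TemperleyLieb

theorem mainTheorem3 {k : Type*} [CommRing k] (n : ℕ) (hn : 0 < n) (δ : k) :
    -- the natural map `σ`, the only algebra map with `σ (e_i) = ê_i`, is an isomorphism
    ∃ σ : TL n δ ≃ₐ[k] DiagramAlgebra n δ,
      (∀ i : Fin (n - 1), σ (gen δ i) = diag δ (Diagram.gen i)) ∧
      (∀ τ : TL n δ →ₐ[k] DiagramAlgebra n δ,
        (∀ i : Fin (n - 1), τ (gen δ i) = diag δ (Diagram.gen i)) → ∀ x, τ x = σ x) ∧
      -- `σ` sends the words in Jones normal form bijectively to the diagrams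
      (∃ f : JonesWord n ≃ Diagram n, ∀ w : JonesWord n,
        σ (wordProd δ w.1) = diag δ (f w)) ∧
      -- `TL_n(δ)` is free, the words in Jones normal form are a basis, and their number is Catalan
      (∃ b : Module.Basis (JonesWord n) k (TL n δ), ∀ w : JonesWord n, b w = wordProd δ w.1) ∧
      Module.Free k (TL n δ) ∧
      (Nat.card (JonesWord n) : ℚ) = 1 / (n + 1) * (2 * n).choose n ∧
      (Nontrivial k → (Module.finrank k (TL n δ) : ℚ) = 1 / (n + 1) * (2 * n).choose n) := by
  refine ⟨AlgEquiv.ofBijective (toDiagramAlgebra δ n) (bijective_toDiagramAlgebra δ),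
    toDiagramAlgebra_gen δ, fun τ hτ x => ?_,
    ⟨Equiv.ofBijective _ bijective_wordDiagram, toDiagramAlgebra_wordProd δ⟩,
    ⟨jonesBasis δ n, jonesBasis_apply δ⟩, .of_basis (jonesBasis δ n), card_jonesWord hn,
    fun _ => ?_⟩
  · exact DFunLike.congr_fun (TL.algHom_ext δ fun i =>
      (hτ i).trans (toDiagramAlgebra_gen δ i).symm) x
  · rw [Module.finrank_eq_nat_card_basis (jonesBasis δ n), card_jonesWord hn]
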